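/- A weighted graph $G=(V,w,m)$ consists of a vertex set $V$, a symmetric function $w:V\times V\to[0,\infty)$ vanishing on the diagonal, and a vertex measure $m:V\to(0,\infty)$. Write $x\sim y$ if $w(x,y)>0$, $\deg(x)=\#\{y: y\sim x\}$, $\mathrm{Deg}(x)=\frac1{m(x)}\sum_y w(x,y)$, and let $\mathrm{dist}_{x_0}$ be the combinatorial distance to $x_0$. Let $\Delta f(x)=\frac1{m(x)}\sum_y w(x,y)(f(y)-f(x))$, $2\Gamma(f,g)=\Delta(fg)-f\Delta g-g\Delta f$ and $2\Gamma_2(f,g)=\Delta\Gamma(f,g)-\Gamma(f,\Delta g)-\Gamma(g,\Delta f)$; $G$ satisfies $CD(K,\infty)$ if $\Gamma_2(f,f)\ge K\,\Gamma(f,f)$ pointwise on $V$ for every $f:V\to\mathbb R$. Let $\langle f,g\rangle=\sum_x f(x)g(x)m(x)$ and $\|f\|_2=\langle f,f\rangle^{1/2}$. For $D>0$, $\delta>1$ and an integer $d\ge1$, let $\mathcal G(D,d,\delta)$ be the collection of connected weighted graphs with $\sup_x\deg(x)=d$, $\sup_x\mathrm{Deg}(x)\le D$ and $\delta^{-1}\le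 m(x)\le\delta$ for all $x\in V$, normalized so that $m(x)=1$ for some vertex $x$. **Theorem.** For every integer $d\ge 1$ and $K>0$ there is a constant $C=C(d,K)>0$ such that for all $D>0$ and $\delta>1$ there is $\epsilon_0=\epsilon_0(D,K,d,\delta)>0$ with the following property. Let $G=(V,w,m)\in\mathcal G(D,d,\delta)$ satisfy $CD(K,\infty)$. Then $V$ is finite. Let $0=\lambda_0<\lambda_1\le\dots\le\lambda_{|V|-1}$ be the eigenvalues of $-\Delta$, repeated according to multiplicity. If $\lambda_d\le K+\epsilon_0$, then for every family $\varphi_1,\dots,\varphi_d$ of functions that are orthonormal with respect to $\langle\cdot,\cdot\rangle$ and satisfy $-\Delta\varphi_i=\lambda_i\varphi_i$ $(1\le i\le d)$, and for every $x_0\in V$, there is $u\in\Lambda(d)=\mathrm{span}\{\varphi_1,\dots,\varphi_d\}$ such that $$\Big\|\mathrm{dist}_{x_0}-\frac d2-u\Big\|_2\le C\,(\lambda_d-K)^{1/2}.$$ -/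

import Mathlib

/-- A weighted graph `(V, w, m)`: symmetric nonnegative weights vanishing on the diagonal, and a
positive vertex measure.  The vertex set may be infinite. -/
structure WeightedGraph (V : Type*) where
  w : V → V → ℝ
  m : V → ℝ
  w_nonneg : ∀ x y, 0 ≤ w x y
  w_symm : ∀ x y, w x y = w y x
  w_self : ∀ x, w x x = 0
  m_pos : ∀ x, 0 < m x

namespace WeightedGraph

noncomputable section

variable {V : Type*} (G : WeightedGraph V)

/-- The underlying combinatorial structure: `x ∼ y` iff `w x y > 0`. -/
def toSimpleGraph : SimpleGraph V where
  Adj x y := 0 < G.w x y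
  symm := ⟨fun x y h => by rw [G.w_symm y x]; exact h⟩
  loopless := ⟨fun x h => by rw [G.w_self x] at h; exact lt_irrefl _ h⟩

/-- The combinatorial vertex degree, possibly infinite. -/
def combDeg (x : V) : ℕ∞ := {y | G.toSimpleGraph.Adj x y}.encard

/-- The maximal combinatorial vertex degree (a supremum in `ℕ∞`). -/
def combDegMax : ℕ∞ := ⨆ x, G.combDeg x

/-- The weighted vertex degree.  The sum is finite when the graph is locally finite. -/
def weightedDeg (x : V) : ℝ := (1 / G.m x) * ∑ᶠ y, G.w x y

/-- The combinatorial distance to `x₀`, as a real function (for connected graphs). -/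
def distFrom (x₀ x : V) : ℝ := (G.toSimpleGraph.dist x₀ x : ℝ)

/-- The graph Laplacian (for locally finite graphs). -/
def lap (f : V → ℝ) (x : V) : ℝ := (1 / G.m x) * ∑ᶠ y, G.w x y * (f y - f x)

/-- The Bakry–Émery operator `Γ`. -/
def Gam (f g : V → ℝ) : V → ℝ :=
  (1 / 2 : ℝ) • (G.lap (f * g) - f * G.lap g - g * G.lap f)

/-- The Bakry–Émery operator `Γ₂`. -/
def Gam2 (f g : V → ℝ) : V → ℝ :=
  (1 / 2 : ℝ) • (G.lap (G.Gam f g) - G.Gam f (G.lap g) - G.Gam g (G.lap f))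

/-- The curvature-dimension condition `CD(K, ∞)`. -/
def CDInfty (K : ℝ) : Prop :=
  ∀ (f : V → ℝ) (x : V), K * G.Gam f f x ≤ G.Gam2 f f x

/-- The class `𝒢(D, d, δ)`.  Its members are locally finite because `deg_max = d < ∞`. -/
structure MemClass (D : ℝ) (d : ℕ) (δ : ℝ) : Prop where
  connected : G.toSimpleGraph.Connected
  combDegMax_eq : G.combDegMax = (d : ℕ∞)
  weightedDeg_le : ∀ x, G.weightedDeg x ≤ D
  le_m : ∀ x, δ⁻¹ ≤ G.m x
  m_le : ∀ x, G.m x ≤ δ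

/-- The inner product of `ℓ₂(V, m)`. -/
def ip (f g : V → ℝ) : ℝ := ∑' x, f x * g x * G.m x

/-- The norm of `ℓ₂(V, m)`. -/
def norm2 (f : V → ℝ) : ℝ := Real.sqrt (∑' x, |f x| ^ 2 * G.m x)

/-- The operator `-Δ` on `C(V) = ℝ^V`, for finite `V`, as a linear map. -/
def negLap [Finite V] : (V → ℝ) →ₗ[ℝ] (V → ℝ) where
  toFun f := - G.lap f
  map_add' f g := by
    funext x
    have h : ∑ᶠ y, G.w x y * ((f + g) y - (f + g) x)
        = ∑ᶠ y, G.w x y * (f y - f x) + ∑ᶠ y, G.w x y * (g y - g x) := by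
      rw [← finsum_add_distrib (Set.toFinite _) (Set.toFinite _)]
      refine finsum_congr fun y => ?_
      simp only [Pi.add_apply]; ring
    simp only [Pi.neg_apply, Pi.add_apply, lap] at h ⊢
    rw [h]; ring
  map_smul' c f := by
    funext x
    have h : ∑ᶠ y, G.w x y * ((c • f) y - (c • f) x) = c * ∑ᶠ y, G.w x y * (f y - f x) := by
      rw [mul_finsum]
      refine finsum_congr fun y => ?_
      simp only [Pi.smul_apply, smul_eq_mul]; ring
    simp only [Pi.neg_apply, Pi.smul_apply, smul_eq_mul, lap, RingHom.id_apply] at h ⊢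
    rw [h]; ring

/-- The eigenvalue `λ_k` of `-Δ` for `k = 0, 1, …, |V| - 1`: the `k`-th entry (starting at `0`) of
the list of all eigenvalues, repeated according to multiplicity, in nondecreasing order. -/
def eigenvalue [Finite V] (k : ℕ) : ℝ :=
  (G.negLap.charpoly.roots.sort (· ≤ ·)).getD k 0

/-- `φ 0, …, φ (d - 1)` are orthonormal eigenfunctions of `-Δ` corresponding to the eigenvalues
`λ₁, …, λ_d`, respectively. -/
structure IsEigenfamily [Finite V] (d : ℕ) (φ : Fin d → V → ℝ) : Prop where
  eigen : ∀ i : Fin d, G.negLap (φ i) = G.eigenvalue ((i : ℕ) + 1) • φ i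
  orthonormal : ∀ i j : Fin d, G.ip (φ i) (φ j) = if i = j then 1 else 0

end

end WeightedGraph

namespace WeightedGraph

noncomputable section

variable {V : Type*} (G : WeightedGraph V)

/-! On the space E spanned by the φ_i, -Δ is within ε = λ_d - K of multiplication by K. The
nonnegative function Γ₂(f) - KΓ(f) has integral ⟨Δf, Δf + Kf⟩, so for f in E it is small, hence
pointwise small because m is bounded below. Then ΔΓ(f) is small as well, and curvature turns this
into a small oscillation of Γ(f): functions in E have almost constant gradient
(`exists_almostRigid`).

Consequently a function in E whose gradient vanishes at one vertex is zero. As dim E = d is the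
maximal degree, every vertex has degree d, and E contains a function with any prescribed gradient at
a given vertex (`card_eq_and_exists_gradient`). A gradient concentrated on one edge shows that the
rates w(x,y)/m(x) are close to K/2 and that m is almost constant, as on a hypercube. If instead f
grows by 1 along each edge at x₀, then -Kf(x₀) ≈ Δf(x₀) ≈ dK/2, so f(x₀) ≈ -d/2. Testing the
curvature condition on f plus a multiple of a point mass at distance two
(`CDInfty.sum_rate_mul_rate_sq_le`) shows that f keeps growing affinely, so f ≈ dist - d/2
(`exists_abs_distFrom_sub_le`).

These estimates have constants depending on D and δ. They are nevertheless enough to place the graph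
in 𝒢(dK, d, 2) once ε is small (`MemClass.of_estimates`). Running them again in that class gives a
constant depending on d and K only. -/

/-- The jump rate `w x y / m x`. -/
def rate (x y : V) : ℝ := G.w x y / G.m x

/-- Finite sets containing all neighbours. -/
def Covers (N : V → Finset V) : Prop := ∀ x y, y ∉ N x → G.w x y = 0

variable {G}

theorem rate_nonneg (x y : V) : 0 ≤ G.rate x y := div_nonneg (G.w_nonneg x y) (G.m_pos x).le

theorem rate_pos {x y : V} (h : G.toSimpleGraph.Adj x y) : 0 < G.rate x y :=
  div_pos h (G.m_pos x)

theorem adj_of_rate_ne_zero {x y : V} (h : G.rate x y ≠ 0) : G.toSimpleGraph.Adj x y := by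
  have : G.w x y ≠ 0 := fun h0 => h (by simp [rate, h0])
  exact lt_of_le_of_ne (G.w_nonneg x y) this.symm

theorem m_mul_rate (x y : V) : G.m x * G.rate x y = G.w x y :=
  mul_div_cancel₀ _ (G.m_pos x).ne'

theorem m_mul_rate_comm (x y : V) : G.m x * G.rate x y = G.m y * G.rate y x := by
  rw [m_mul_rate, m_mul_rate, G.w_symm]

/-! ### Local sum formulas and elementary bounds for Δ and Γ. -/

section Local

variable {N : V → Finset V} (hN : G.Covers N)
include hN

theorem Covers.finsum_eq (x : V) (g : V → ℝ) :
    (1 / G.m x) * ∑ᶠ y, G.w x y * g y = ∑ y ∈ N x, G.rate x y * g y := by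
  rw [finsum_eq_sum_of_support_subset (s := N x), Finset.mul_sum]
  · refine Finset.sum_congr rfl fun y _ => ?_
    simp only [rate]; ring
  · intro y hy
    by_contra h
    exact hy (by simp [hN x y (by simpa using h)])

theorem Covers.lap_eq (f : V → ℝ) (x : V) :
    G.lap f x = ∑ y ∈ N x, G.rate x y * (f y - f x) := hN.finsum_eq x fun y => f y - f x

theorem Covers.weightedDeg_eq (x : V) : G.weightedDeg x = ∑ y ∈ N x, G.rate x y := by
  simpa [weightedDeg] using hN.finsum_eq x fun _ => 1

theorem Covers.Gam_eq (f g : V → ℝ) (x : V) :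
    G.Gam f g x = 1 / 2 * ∑ y ∈ N x, G.rate x y * ((f y - f x) * (g y - g x)) := by
  simp only [Gam, Pi.smul_apply, Pi.sub_apply, Pi.mul_apply, hN.lap_eq, smul_eq_mul,
    Finset.mul_sum, ← Finset.sum_sub_distrib]
  refine Finset.sum_congr rfl fun y _ => ?_
  ring

theorem Covers.Gam_comm (f g : V → ℝ) : G.Gam f g = G.Gam g f := by
  funext x
  rw [hN.Gam_eq, hN.Gam_eq]
  congr 1
  exact Finset.sum_congr rfl fun y _ => by ring

theorem Covers.lap_add (f g : V → ℝ) : G.lap (f + g) = G.lap f + G.lap g := by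
  funext x
  simp only [hN.lap_eq, Pi.add_apply, ← Finset.sum_add_distrib]
  exact Finset.sum_congr rfl fun y _ => by ring

theorem Covers.lap_smul (c : ℝ) (f : V → ℝ) : G.lap (c • f) = c • G.lap f := by
  funext x
  simp only [hN.lap_eq, Pi.smul_apply, smul_eq_mul, Finset.mul_sum]
  exact Finset.sum_congr rfl fun y _ => by ring

theorem Covers.Gam_add_right (f g k : V → ℝ) : G.Gam f (g + k) = G.Gam f g + G.Gam f k := by
  funext x
  simp only [hN.Gam_eq, Pi.add_apply, ← mul_add, ← Finset.sum_add_distrib]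
  congr 1
  exact Finset.sum_congr rfl fun y _ => by ring

theorem Covers.Gam_smul_right (c : ℝ) (f g : V → ℝ) : G.Gam f (c • g) = c • G.Gam f g := by
  funext x
  simp only [hN.Gam_eq, Pi.smul_apply, smul_eq_mul, Finset.mul_sum]
  exact Finset.sum_congr rfl fun y _ => by ring

theorem Covers.Gam_add_left (f g k : V → ℝ) : G.Gam (f + g) k = G.Gam f k + G.Gam g k := by
  rw [hN.Gam_comm, hN.Gam_add_right, hN.Gam_comm k f, hN.Gam_comm k g]

theorem Covers.Gam_smul_left (c : ℝ) (f g : V → ℝ) : G.Gam (c • f) g = c • G.Gam f g := by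
  rw [hN.Gam_comm, hN.Gam_smul_right, hN.Gam_comm]

theorem Covers.Gam_self_nonneg (f : V → ℝ) (x : V) : 0 ≤ G.Gam f f x := by
  rw [hN.Gam_eq]
  have : 0 ≤ ∑ y ∈ N x, G.rate x y * ((f y - f x) * (f y - f x)) :=
    Finset.sum_nonneg fun y _ => mul_nonneg (rate_nonneg x y) (mul_self_nonneg _)
  linarith

theorem Covers.mem_of_adj {x y : V} (h : G.toSimpleGraph.Adj x y) : y ∈ N x := by
  by_contra hy
  exact absurd (hN x y hy) (ne_of_gt h)

theorem Covers.rate_mul_sq_le (f : V → ℝ) {x y : V} (h : G.toSimpleGraph.Adj x y) :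
    G.rate x y * (f y - f x) ^ 2 ≤ 2 * G.Gam f f x := by
  rw [hN.Gam_eq]
  have := Finset.single_le_sum (f := fun y => G.rate x y * ((f y - f x) * (f y - f x)))
    (fun y _ => mul_nonneg (rate_nonneg x y) (mul_self_nonneg _)) (hN.mem_of_adj h)
  nlinarith

theorem Covers.abs_Gam_le {D a b : ℝ} {x : V} (hD : G.weightedDeg x ≤ D) {f g : V → ℝ}
    (hf : ∀ y, |f y - f x| ≤ a) (hg : ∀ y, |g y - g x| ≤ b) :
    |G.Gam f g x| ≤ D * (a * b) / 2 := by
  have ha : 0 ≤ a := (abs_nonneg _).trans (hf x)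
  have hb : 0 ≤ b := (abs_nonneg _).trans (hg x)
  rw [hN.Gam_eq, abs_mul, abs_of_pos (by norm_num : (0 : ℝ) < 1 / 2)]
  have h1 : |∑ y ∈ N x, G.rate x y * ((f y - f x) * (g y - g x))|
      ≤ ∑ y ∈ N x, G.rate x y * (a * b) := by
    refine (Finset.abs_sum_le_sum_abs _ _).trans (Finset.sum_le_sum fun y _ => ?_)
    rw [abs_mul, abs_of_nonneg (rate_nonneg x y), abs_mul]
    exact mul_le_mul_of_nonneg_left (mul_le_mul (hf y) (hg y) (abs_nonneg _) ha)
      (rate_nonneg x y)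
  rw [← Finset.sum_mul, ← hN.weightedDeg_eq] at h1
  have := mul_le_mul_of_nonneg_right hD (mul_nonneg ha hb)
  linarith

theorem Covers.lap_sq_le {D : ℝ} {x : V} (hD : G.weightedDeg x ≤ D) (f : V → ℝ) :
    G.lap f x ^ 2 ≤ 2 * D * G.Gam f f x := by
  have h1 : G.lap f x ^ 2
      ≤ (∑ y ∈ N x, G.rate x y) * ∑ y ∈ N x, G.rate x y * ((f y - f x) * (f y - f x)) := by
    rw [hN.lap_eq]
    refine Finset.sum_sq_le_sum_mul_sum_of_sq_le_mul _ (fun y _ => rate_nonneg x y)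
      (fun y _ => mul_nonneg (rate_nonneg x y) (mul_self_nonneg _)) fun y _ => le_of_eq (by ring)
  have h2 : ∑ y ∈ N x, G.rate x y * ((f y - f x) * (f y - f x)) = 2 * G.Gam f f x := by
    rw [hN.Gam_eq]; ring
  rw [h2, ← hN.weightedDeg_eq] at h1
  nlinarith [hN.Gam_self_nonneg f x]

/-! ### Gradient contraction, oscillation and diameter bounds. -/

/-- One step of the explicit Euler scheme for the heat flow contracts the gradient. -/
theorem Covers.Gam_heatStep_le {D K h M : ℝ} (hD : ∀ x, G.weightedDeg x ≤ D)
    (hCD : G.CDInfty K) (hh : 0 ≤ h) (h1 : h * (2 * K + D) ≤ 1)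
    (h2 : 4 * D ^ 2 * h ≤ K) {f : V → ℝ} (hM : ∀ x, G.Gam f f x ≤ M) (x : V) :
    G.Gam (f + h • G.lap f) (f + h • G.lap f) x ≤ (1 - h * K) * M := by
  have hM0 : 0 ≤ M := (hN.Gam_self_nonneg f x).trans (hM x)
  have hD0 : 0 ≤ D := by
    refine le_trans ?_ (hD x)
    rw [hN.weightedDeg_eq]
    exact Finset.sum_nonneg fun y _ => rate_nonneg x y
  have hlap : ∀ y, |G.lap f y| ≤ √(2 * D * M) := fun y =>
    Real.abs_le_sqrt ((hN.lap_sq_le (hD y) f).trans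
      (mul_le_mul_of_nonneg_left (hM y) (by positivity)))
  have hdiff : ∀ y, |G.lap f y - G.lap f x| ≤ 2 * √(2 * D * M) := fun y => by
    have := abs_sub (G.lap f y) (G.lap f x)
    linarith [hlap x, hlap y]
  have hG := (le_abs_self _).trans (hN.abs_Gam_le (hD x) hdiff hdiff)
  have hs : √(2 * D * M) * √(2 * D * M) = 2 * D * M := Real.mul_self_sqrt (by positivity)
  have hG' : G.Gam (G.lap f) (G.lap f) x ≤ 4 * D ^ 2 * M := by
    calc _ ≤ _ := hG
      _ = 2 * D * (√(2 * D * M) * √(2 * D * M)) := by ring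
      _ = _ := by rw [hs]; ring
  have hcd := hCD f x
  have hexp : G.Gam (f + h • G.lap f) (f + h • G.lap f) x
      = G.Gam f f x + 2 * h * G.Gam f (G.lap f) x + h ^ 2 * G.Gam (G.lap f) (G.lap f) x := by
    simp only [hN.Gam_add_left, hN.Gam_add_right, hN.Gam_smul_left, hN.Gam_smul_right,
      Pi.add_apply, Pi.smul_apply, smul_eq_mul, hN.Gam_comm (G.lap f) f]
    ring
  have hg2 : G.Gam2 f f x = 1 / 2 * G.lap (G.Gam f f) x - G.Gam f (G.lap f) x := by
    simp only [Gam2, Pi.smul_apply, Pi.sub_apply, smul_eq_mul]; ring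
  have hlapG : G.lap (G.Gam f f) x ≤ G.weightedDeg x * (M - G.Gam f f x) := by
    rw [hN.lap_eq, hN.weightedDeg_eq, Finset.sum_mul]
    refine Finset.sum_le_sum fun y _ => mul_le_mul_of_nonneg_left ?_ (rate_nonneg x y)
    linarith [hM y]
  have h5 : G.weightedDeg x * (M - G.Gam f f x) ≤ D * (M - G.Gam f f x) :=
    mul_le_mul_of_nonneg_right (hD x) (by linarith [hM x])
  have h6 : h * G.lap (G.Gam f f) x ≤ h * (D * (M - G.Gam f f x)) :=
    mul_le_mul_of_nonneg_left (hlapG.trans h5) hh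
  -- Curvature yields a decay 2hK; the second-order error of the Euler step may use up half of it.
  have h7 : h ^ 2 * G.Gam (G.lap f) (G.lap f) x ≤ h * K * M := by
    calc h ^ 2 * G.Gam (G.lap f) (G.lap f) x ≤ h ^ 2 * (4 * D ^ 2 * M) :=
          mul_le_mul_of_nonneg_left hG' (by positivity)
      _ = (4 * D ^ 2 * h) * (h * M) := by ring
      _ ≤ K * (h * M) := mul_le_mul_of_nonneg_right h2 (by positivity)
      _ = _ := by ring
  have h8 : h * (K * G.Gam f f x) ≤ h * G.Gam2 f f x := mul_le_mul_of_nonneg_left hcd hh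
  -- The step is short enough that Γ(f)(x) enters with a nonnegative coefficient and can be replaced
  -- by its bound M.
  have h9 : (1 - h * (2 * K + D)) * G.Gam f f x ≤ (1 - h * (2 * K + D)) * M :=
    mul_le_mul_of_nonneg_left (hM x) (by linarith)
  rw [hexp]
  rw [hg2] at h8
  nlinarith

/-- Under `CD(K, ∞)` with `K > 0`, a gradient bound gives an oscillation bound. -/
theorem Covers.abs_sub_le {D K M : ℝ} (hconn : G.toSimpleGraph.Connected)
    (hD : ∀ x, G.weightedDeg x ≤ D) (hCD : G.CDInfty K) (hD0 : 0 < D) (hK : 0 < K)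
    {f : V → ℝ} (hM : ∀ x, G.Gam f f x ≤ M) (x y : V) :
    |f x - f y| ≤ 4 * √(2 * D * M) / K := by
  have hM0 : 0 ≤ M := (hN.Gam_self_nonneg f x).trans (hM x)
  obtain ⟨h, hh, h1, h2⟩ : ∃ h : ℝ, 0 < h ∧ h * (2 * K + D) ≤ 1 ∧ 4 * D ^ 2 * h ≤ K := by
    refine ⟨K / (4 * D ^ 2 + K * (2 * K + D)), by positivity, ?_, ?_⟩
    · rw [div_mul_eq_mul_div, div_le_one (by positivity)]; nlinarith [sq_nonneg D]
    · rw [mul_div_assoc', div_le_iff₀ (by positivity)]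
      nlinarith [mul_pos (mul_pos hK hK) hD0, pow_pos hK 3]
  have hhK : 0 ≤ 1 - h * K := by nlinarith
  set T : (V → ℝ) → V → ℝ := fun f => f + h • G.lap f with hT
  have hΓ : ∀ n x, G.Gam (T^[n] f) (T^[n] f) x ≤ (1 - h * K) ^ n * M := by
    intro n
    induction n with
    | zero => simpa using hM
    | succ n ih =>
      intro x
      rw [Function.iterate_succ_apply', pow_succ', mul_assoc]
      exact hN.Gam_heatStep_le hD hCD hh.le h1 h2 ih x
  set ρ := √(1 - h * K) with hρ
  have hρ0 : 0 ≤ ρ := Real.sqrt_nonneg _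
  have hρ2 : ρ ^ 2 = 1 - h * K := Real.sq_sqrt hhK
  have hρ1 : ρ < 1 := by nlinarith [mul_pos hh hK]
  set S := √(2 * D * M) with hS
  have hS0 : 0 ≤ S := Real.sqrt_nonneg _
  have hS2 : S ^ 2 = 2 * D * M := Real.sq_sqrt (by positivity)
  have hstep : ∀ n x, |T^[n] f x - f x| ≤ 2 * S / K * (1 - ρ ^ n) := by
    intro n x
    induction n with
    | zero => simp
    | succ n ih =>
      have hl : |G.lap (T^[n] f) x| ≤ ρ ^ n * S := by
        apply abs_le_of_sq_le_sq _ (by positivity)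
        calc G.lap (T^[n] f) x ^ 2 ≤ 2 * D * G.Gam (T^[n] f) (T^[n] f) x :=
              hN.lap_sq_le (hD x) _
          _ ≤ 2 * D * ((1 - h * K) ^ n * M) :=
              mul_le_mul_of_nonneg_left (hΓ n x) (by positivity)
          _ = (ρ ^ 2) ^ n * (2 * D * M) := by rw [hρ2]; ring
          _ = (ρ ^ 2) ^ n * S ^ 2 := by rw [hS2]
          _ = (ρ ^ n * S) ^ 2 := by ring
      have e1 : T^[n + 1] f x - f x = (T^[n] f x - f x) + h * G.lap (T^[n] f) x := by
        rw [Function.iterate_succ_apply']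
        simp only [hT, Pi.add_apply, Pi.smul_apply, smul_eq_mul]; ring
      -- Here hK = 1 - ρ² = (1 - ρ)(1 + ρ). The increments thus sum to at most 2S/K, whatever the
      -- step size h.
      have e2 : h * K ≤ 2 * (1 - ρ) := by nlinarith
      have e3 : h ≤ 2 / K * (1 - ρ) := by
        rw [div_mul_eq_mul_div, le_div_iff₀ hK]; exact e2
      have e4 : |h * G.lap (T^[n] f) x| ≤ 2 / K * (1 - ρ) * (ρ ^ n * S) := by
        rw [abs_mul, abs_of_pos hh]
        exact mul_le_mul e3 hl (abs_nonneg _) (hh.le.trans e3)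
      rw [e1]
      refine (abs_add_le _ _).trans ((add_le_add ih e4).trans (le_of_eq ?_))
      rw [pow_succ]; ring
  -- The gradient decays geometrically, so the flow flattens along each edge, hence along each path;
  -- f is within 2S/K of these iterates.
  have hlim : ∀ x y, Filter.Tendsto (fun n => T^[n] f x - T^[n] f y) Filter.atTop (nhds 0) := by
    have hadj : ∀ x y, G.toSimpleGraph.Adj x y →
        Filter.Tendsto (fun n => T^[n] f x - T^[n] f y) Filter.atTop (nhds 0) := by
      intro x y hxy
      have hp := rate_pos hxy
      apply squeeze_zero_norm (a := fun n => ρ ^ n * √(2 * M / G.rate x y))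
      · intro n
        rw [Real.norm_eq_abs]
        apply abs_le_of_sq_le_sq _ (by positivity)
        rw [mul_pow, Real.sq_sqrt (by positivity), ← pow_mul, mul_comm n 2, pow_mul, hρ2]
        have h3 := hN.rate_mul_sq_le (T^[n] f) hxy
        have h4 := hΓ n x
        rw [mul_div_assoc', le_div_iff₀ hp]
        nlinarith
      · simpa using (tendsto_pow_atTop_nhds_zero_of_lt_one hρ0 hρ1).mul_const
          (√(2 * M / G.rate x y))
    intro x y
    obtain ⟨q⟩ := hconn.preconnected x y
    induction q with
    | nil => simp
    | cons hab _ ih => simpa using (hadj _ _ hab).add ih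
  have hfin : ∀ n, |f x - f y| ≤ 4 * S / K + |T^[n] f x - T^[n] f y| := by
    intro n
    have hx := hstep n x
    have hy := hstep n y
    have hb : 2 * S / K * (1 - ρ ^ n) ≤ 2 * S / K :=
      mul_le_of_le_one_right (by positivity) (by linarith [pow_nonneg hρ0 n])
    have e : f x - f y = (T^[n] f x - T^[n] f y) + (-(T^[n] f x - f x) + (T^[n] f y - f y)) := by
      ring
    rw [e]
    refine (abs_add_le _ _).trans ?_
    have := abs_add_le (-(T^[n] f x - f x)) (T^[n] f y - f y)
    rw [abs_neg] at this
    have e5 : 4 * S / K = 2 * S / K + 2 * S / K := by ring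
    linarith
  have hl := ((hlim x y).abs.const_add (4 * S / K))
  rw [abs_zero, add_zero] at hl
  exact ge_of_tendsto' hl hfin

/-- The distance function is 1-Lipschitz, so Γ ≤ D/2, and its oscillation bound is a diameter bound.
-/
theorem Covers.dist_le {D K : ℝ} (hconn : G.toSimpleGraph.Connected)
    (hD : ∀ x, G.weightedDeg x ≤ D) (hCD : G.CDInfty K) (hD0 : 0 < D) (hK : 0 < K) (x y : V) :
    (G.toSimpleGraph.dist x y : ℝ) ≤ 4 * D / K := by
  have hΓ : ∀ z, G.Gam (G.distFrom x) (G.distFrom x) z ≤ D / 2 := by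
    intro z
    rw [hN.Gam_eq]
    have : ∑ y ∈ N z, G.rate z y *
        ((G.distFrom x y - G.distFrom x z) * (G.distFrom x y - G.distFrom x z))
        ≤ ∑ y ∈ N z, G.rate z y := by
      refine Finset.sum_le_sum fun y _ => ?_
      rcases eq_or_ne (G.rate z y) 0 with h0 | h0
      · simp [h0]
      · refine mul_le_of_le_one_right (rate_nonneg z y) ?_
        have hadj := adj_of_rate_ne_zero h0
        rw [← sq, sq_le_one_iff_abs_le_one, abs_le]
        have h1 := hconn.dist_triangle (u := x) (v := z) (w := y)
        have h2 := hconn.dist_triangle (u := x) (v := y) (w := z)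
        rw [SimpleGraph.dist_eq_one_iff_adj.mpr hadj] at h1
        rw [SimpleGraph.dist_eq_one_iff_adj.mpr hadj.symm] at h2
        have h1' : (G.toSimpleGraph.dist x y : ℝ) ≤ G.toSimpleGraph.dist x z + 1 := by
          exact_mod_cast h1
        have h2' : (G.toSimpleGraph.dist x z : ℝ) ≤ G.toSimpleGraph.dist x y + 1 := by
          exact_mod_cast h2
        simp only [distFrom]
        constructor <;> linarith
    rw [← hN.weightedDeg_eq] at this
    linarith [hD z]
  have := hN.abs_sub_le hconn hD hCD hD0 hK hΓ y x
  rw [show 2 * D * (D / 2) = D ^ 2 by ring, Real.sqrt_sq hD0.le] at this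
  simp only [distFrom, SimpleGraph.dist_self, Nat.cast_zero, sub_zero, Nat.abs_cast] at this
  exact this

end Local

/-! ### Ball growth and finiteness of the graph. -/

theorem exists_finset_dist_le {d : ℕ} {N : V → Finset V} (hN : G.Covers N)
    (hconn : G.toSimpleGraph.Connected) (hd : ∀ x, (N x).card ≤ d) (x : V) (n : ℕ) :
    ∃ s : Finset V, s.card ≤ (d + 1) ^ n ∧ ∀ y, G.toSimpleGraph.dist x y ≤ n → y ∈ s := by
  classical
  induction n with
  | zero =>
    refine ⟨{x}, by simp, fun y hy => ?_⟩
    have := (hconn.dist_eq_zero_iff (u := x) (v := y)).mp (by omega)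
    simp [this]
  | succ n ih =>
    obtain ⟨s, hs, h⟩ := ih
    refine ⟨s.biUnion fun y => insert y (N y), ?_, fun y hy => ?_⟩
    · calc _ ≤ s.card * (d + 1) := Finset.card_biUnion_le_card_mul _ _ _ fun y _ =>
            (Finset.card_insert_le _ _).trans (by have := hd y; omega)
        _ ≤ (d + 1) ^ n * (d + 1) := Nat.mul_le_mul_right _ hs
        _ = _ := (pow_succ _ _).symm
    · rw [Finset.mem_biUnion]
      rcases hy.lt_or_eq with hlt | heq
      · exact ⟨y, h y (by omega), Finset.mem_insert_self _ _⟩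
      · obtain ⟨q, hq⟩ := (hconn.preconnected y x).exists_walk_length_eq_dist
        rw [SimpleGraph.dist_comm, heq] at hq
        cases q with
        | nil => simp at hq
        | cons hab q' =>
          rename_i z
          refine ⟨z, h z ?_, Finset.mem_insert_of_mem (hN.mem_of_adj hab.symm)⟩
          rw [SimpleGraph.dist_comm]
          refine (SimpleGraph.dist_le q').trans ?_
          simp only [SimpleGraph.Walk.length_cons] at hq
          omega

/-- Neighbourhoods in a graph of bounded degree. -/
theorem exists_covers {d : ℕ} (h : G.combDegMax = (d : ℕ∞)) :
    ∃ N : V → Finset V, G.Covers N ∧ (∀ x, (N x).card ≤ d) ∧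
      ∀ x y, y ∈ N x ↔ G.toSimpleGraph.Adj x y := by
  have h1 : ∀ x, {y | G.toSimpleGraph.Adj x y}.encard ≤ d := fun x => by
    rw [← h]; exact le_iSup G.combDeg x
  have hf : ∀ x, {y | G.toSimpleGraph.Adj x y}.Finite := fun x =>
    Set.finite_of_encard_le_coe (h1 x)
  refine ⟨fun x => (hf x).toFinset, fun x y hy => ?_, fun x => ?_, fun x y => by simp⟩
  · by_contra h0
    exact hy ((hf x).mem_toFinset.mpr (lt_of_le_of_ne (G.w_nonneg x y) (Ne.symm h0)))
  · have := h1 x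
    rw [(hf x).encard_eq_coe_toFinset_card] at this
    exact_mod_cast this

/-- Bonnet–Myers: a graph in the class with positive curvature is finite. -/
theorem MemClass.finite_and_card_le {D δ K : ℝ} {d : ℕ} (hG : G.MemClass D d δ)
    (hD0 : 0 < D) (hK : 0 < K) (hCD : G.CDInfty K) :
    Finite V ∧ Nat.card V ≤ (d + 1) ^ ⌈4 * D / K⌉₊ := by
  obtain ⟨N, hN, hd, -⟩ := exists_covers hG.combDegMax_eq
  obtain ⟨x⟩ := hG.connected.nonempty
  obtain ⟨s, hs, h⟩ := exists_finset_dist_le hN hG.connected hd x ⌈4 * D / K⌉₊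
  have hall : ∀ y, y ∈ s := fun y => h y (by
    have := (hN.dist_le hG.connected hG.weightedDeg_le hCD hD0 hK x y).trans (Nat.le_ceil _)
    exact_mod_cast this)
  have : Fintype V := ⟨s, hall⟩
  refine ⟨inferInstance, ?_⟩
  rw [Nat.card_eq_fintype_card, ← Finset.card_univ]
  exact (Finset.card_le_card fun y _ => hall y).trans hs

theorem Gam2_self (f : V → ℝ) (x : V) :
    G.Gam2 f f x = 1 / 2 * G.lap (G.Gam f f) x - G.Gam f (G.lap f) x := by
  simp only [Gam2, Pi.smul_apply, Pi.sub_apply, smul_eq_mul]; ring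

/-! ### Integration by parts on finite graphs and the integrated curvature inequality. -/

section Finite

variable [Fintype V]

theorem covers_univ : G.Covers fun _ => Finset.univ := fun _ y hy =>
  absurd (Finset.mem_univ y) hy

variable (G) in
/-- The squared `ℓ₂(V, m)` norm. -/
def normSq (f : V → ℝ) : ℝ := ∑ x, G.m x * f x ^ 2

theorem normSq_nonneg (f : V → ℝ) : 0 ≤ G.normSq f :=
  Finset.sum_nonneg fun x _ => mul_nonneg (G.m_pos x).le (sq_nonneg _)

theorem m_mul_sq_le_normSq (f : V → ℝ) (x : V) : G.m x * f x ^ 2 ≤ G.normSq f :=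
  Finset.single_le_sum (f := fun x => G.m x * f x ^ 2)
    (fun x _ => mul_nonneg (G.m_pos x).le (sq_nonneg _)) (Finset.mem_univ x)

theorem abs_sum_mul_le {f g : V → ℝ} {a b s : ℝ} (ha : 0 ≤ a) (hb : 0 ≤ b) (hs : 0 ≤ s)
    (hf : G.normSq f ≤ a ^ 2 * s) (hg : G.normSq g ≤ b ^ 2 * s) :
    |∑ x, G.m x * (f x * g x)| ≤ a * b * s := by
  apply abs_le_of_sq_le_sq _ (by positivity)
  have h : (∑ x, G.m x * (f x * g x)) ^ 2 ≤ G.normSq f * G.normSq g := by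
    refine Finset.sum_sq_le_sum_mul_sum_of_sq_le_mul _
      (fun x _ => mul_nonneg (G.m_pos x).le (sq_nonneg _))
      (fun x _ => mul_nonneg (G.m_pos x).le (sq_nonneg _)) fun x _ => le_of_eq (by ring)
  calc _ ≤ _ := h
    _ ≤ (a ^ 2 * s) * (b ^ 2 * s) := mul_le_mul hf hg (normSq_nonneg g) (by positivity)
    _ = _ := by ring

theorem sum_m_mul_lap (f g : V → ℝ) :
    ∑ x, G.m x * (f x * G.lap g x) = -∑ x, G.m x * G.Gam f g x := by
  have h1 : ∑ x, G.m x * (f x * G.lap g x) = ∑ x, ∑ y, G.w x y * (f x * (g y - g x)) := by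
    refine Finset.sum_congr rfl fun x _ => ?_
    rw [covers_univ.lap_eq, Finset.mul_sum, Finset.mul_sum]
    refine Finset.sum_congr rfl fun y _ => ?_
    rw [← m_mul_rate]; ring
  have h2 : ∑ x, ∑ y, G.w x y * (f x * (g y - g x))
      = ∑ x, ∑ y, G.w x y * (f y * (g x - g y)) := by
    rw [Finset.sum_comm]
    exact Finset.sum_congr rfl fun x _ => Finset.sum_congr rfl fun y _ => by rw [G.w_symm]
  have h3 : ∑ x, G.m x * G.Gam f g x
      = 1 / 2 * ∑ x, ∑ y, G.w x y * ((f y - f x) * (g y - g x)) := by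
    rw [Finset.mul_sum]
    refine Finset.sum_congr rfl fun x _ => ?_
    rw [covers_univ.Gam_eq, mul_left_comm, Finset.mul_sum]
    congr 1
    refine Finset.sum_congr rfl fun y _ => ?_
    rw [← m_mul_rate]; ring
  have h4 : ∑ x, ∑ y, G.w x y * ((f y - f x) * (g y - g x))
      = -∑ x, ∑ y, G.w x y * (f x * (g y - g x)) - ∑ x, ∑ y, G.w x y * (f y * (g x - g y)) := by
    simp only [← Finset.sum_neg_distrib, ← Finset.sum_sub_distrib]
    exact Finset.sum_congr rfl fun x _ => Finset.sum_congr rfl fun y _ => by ring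
  rw [h3, h4, h1, ← h2]; ring

theorem sum_m_mul_lap_eq_zero (g : V → ℝ) : ∑ x, G.m x * G.lap g x = 0 := by
  have h := G.sum_m_mul_lap 1 g
  have h0 : ∀ x, G.Gam 1 g x = 0 := fun x => by simp [covers_univ.Gam_eq]
  simpa [h0] using h

theorem sum_m_mul_Gam2 (f : V → ℝ) : ∑ x, G.m x * G.Gam2 f f x = G.normSq (G.lap f) := by
  have h1 : ∑ x, G.m x * G.Gam2 f f x
      = 1 / 2 * ∑ x, G.m x * G.lap (G.Gam f f) x - ∑ x, G.m x * G.Gam f (G.lap f) x := by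
    rw [Finset.mul_sum, ← Finset.sum_sub_distrib]
    exact Finset.sum_congr rfl fun x _ => by rw [Gam2_self]; ring
  rw [h1, sum_m_mul_lap_eq_zero, covers_univ.Gam_comm, mul_zero, zero_sub, ← sum_m_mul_lap]
  exact Finset.sum_congr rfl fun x _ => by ring

/-- The integrated curvature inequality, equivalent to the Lichnerowicz estimate. -/
theorem CDInfty.mul_sum_Gam_le {K : ℝ} (hCD : G.CDInfty K) (f : V → ℝ) :
    K * ∑ x, G.m x * G.Gam f f x ≤ G.normSq (G.lap f) := by
  rw [← sum_m_mul_Gam2, Finset.mul_sum]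
  refine Finset.sum_le_sum fun x _ => ?_
  have := mul_le_mul_of_nonneg_left (hCD f x) (G.m_pos x).le
  linarith

theorem le_mul_sum_of_nonneg {δ : ℝ} (hδ : ∀ x, 1 ≤ δ * G.m x) {g : V → ℝ} (hg : ∀ x, 0 ≤ g x)
    (x : V) : g x ≤ δ * ∑ y, G.m y * g y := by
  have hδ0 : 0 < δ := pos_of_mul_pos_left (lt_of_lt_of_le one_pos (hδ x)) (G.m_pos x).le
  have h1 : G.m x * g x ≤ ∑ y, G.m y * g y :=
    Finset.single_le_sum (f := fun y => G.m y * g y)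
      (fun y _ => mul_nonneg (G.m_pos y).le (hg y)) (Finset.mem_univ x)
  calc g x ≤ (δ * G.m x) * g x := le_mul_of_one_le_left (hg x) (hδ x)
    _ = δ * (G.m x * g x) := by ring
    _ ≤ _ := mul_le_mul_of_nonneg_left h1 hδ0.le

/-! ### From near-extremal eigenvalues to pointwise almost rigidity. -/

/-- A space of functions on which `-Δ` is almost multiplication by the curvature bound `K`. -/
structure NearExtremal (G : WeightedGraph V) (D K δ ε : ℝ) (E : Submodule ℝ (V → ℝ)) : Prop where
  connected : G.toSimpleGraph.Connected
  curvature : G.CDInfty K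
  weightedDeg_le : ∀ x, G.weightedDeg x ≤ D
  one_le : ∀ x, 1 ≤ δ * G.m x
  m_le : ∀ x, G.m x ≤ δ
  normSq_le : ∀ f ∈ E, G.normSq (G.lap f + K • f) ≤ ε ^ 2 * G.normSq f

/-- Functions in `E` have almost constant gradient, are almost eigenfunctions and almost attain
equality in the curvature inequality, all errors being relative to the gradient. -/
structure AlmostRigid (G : WeightedGraph V) (K A σ : ℝ) (E : Submodule ℝ (V → ℝ)) : Prop where
  Gam_le : ∀ f ∈ E, ∀ x y, G.Gam f f y ≤ G.Gam f f x + A * σ ^ 2 * G.Gam f f x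
  sq_le : ∀ f ∈ E, ∀ x y, f x ^ 2 ≤ A * G.Gam f f y
  lap_le : ∀ f ∈ E, ∀ x y, (G.lap f x + K * f x) ^ 2 ≤ A * σ ^ 2 * G.Gam f f y
  Gam2_le : ∀ f ∈ E, ∀ x y, G.Gam2 f f x ≤ K * G.Gam f f x + A * σ ^ 2 * G.Gam f f y

namespace NearExtremal

variable {D K δ ε : ℝ} {E : Submodule ℝ (V → ℝ)} (h : G.NearExtremal D K δ ε E)
include h

theorem δ_pos : 0 < δ := by
  obtain ⟨x⟩ := h.connected.nonempty
  exact (G.m_pos x).trans_le (h.m_le x)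

theorem sq_le_normSq (f : V → ℝ) (x : V) : f x ^ 2 ≤ δ * G.normSq f :=
  le_mul_sum_of_nonneg h.one_le (g := fun x => f x ^ 2) (fun _ => sq_nonneg _) x

theorem lap_add_sq_le {f : V → ℝ} (hf : f ∈ E) (x : V) :
    (G.lap f x + K * f x) ^ 2 ≤ δ * ε ^ 2 * G.normSq f := by
  have h1 := h.sq_le_normSq (G.lap f + K • f) x
  have h2 := mul_le_mul_of_nonneg_left (h.normSq_le f hf) h.δ_pos.le
  simp only [Pi.add_apply, Pi.smul_apply, smul_eq_mul] at h1
  linarith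

theorem normSq_lap_le (hε : 0 ≤ ε) (hεK : ε ≤ K) {f : V → ℝ} (hf : f ∈ E) :
    G.normSq (G.lap f) ≤ (2 * K) ^ 2 * G.normSq f := by
  have h1 : G.normSq (G.lap f) ≤ 2 * G.normSq (G.lap f + K • f) + 2 * K ^ 2 * G.normSq f := by
    simp only [normSq, Finset.mul_sum, ← Finset.sum_add_distrib]
    refine Finset.sum_le_sum fun x _ => ?_
    simp only [Pi.add_apply, Pi.smul_apply, smul_eq_mul]
    nlinarith [mul_nonneg (G.m_pos x).le (sq_nonneg (G.lap f x + 2 * K * f x))]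
  have h2 := h.normSq_le f hf
  have h3 : ε ^ 2 * G.normSq f ≤ K ^ 2 * G.normSq f :=
    mul_le_mul_of_nonneg_right (pow_le_pow_left₀ hε hεK 2) (normSq_nonneg f)
  nlinarith

/-- The defect Γ₂(f) - KΓ(f) is nonnegative, so each of its values is at most δ times its integral
⟨Δf, Δf + Kf⟩; Cauchy–Schwarz bounds the latter. -/
theorem Gam2_le (hε : 0 ≤ ε) (hεK : ε ≤ K) {f : V → ℝ} (hf : f ∈ E) (x : V) :
    G.Gam2 f f x - K * G.Gam f f x ≤ 2 * K * δ * ε * G.normSq f := by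
  have h1 := le_mul_sum_of_nonneg h.one_le (g := fun x => G.Gam2 f f x - K * G.Gam f f x)
    (fun y => sub_nonneg.mpr (h.curvature f y)) x
  have h2 : ∑ y, G.m y * (G.Gam2 f f y - K * G.Gam f f y)
      = ∑ y, G.m y * (G.lap f y * (G.lap f + K • f) y) := by
    have e1 : ∑ y, G.m y * (G.Gam2 f f y - K * G.Gam f f y)
        = ∑ y, G.m y * G.Gam2 f f y - K * ∑ y, G.m y * G.Gam f f y := by
      rw [Finset.mul_sum, ← Finset.sum_sub_distrib]
      exact Finset.sum_congr rfl fun y _ => by ring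
    have e2 := G.sum_m_mul_lap f f
    rw [e1, sum_m_mul_Gam2, ← neg_eq_iff_eq_neg.mpr e2, normSq, mul_neg, sub_neg_eq_add,
      Finset.mul_sum, ← Finset.sum_add_distrib]
    refine Finset.sum_congr rfl fun y _ => ?_
    simp only [Pi.add_apply, Pi.smul_apply, smul_eq_mul]; ring
  have h3 := abs_sum_mul_le (by linarith) hε (normSq_nonneg f)
    (h.normSq_lap_le hε hεK hf) (h.normSq_le f hf)
  rw [h2] at h1
  calc _ ≤ _ := h1
    _ ≤ δ * (2 * K * ε * G.normSq f) :=
      mul_le_mul_of_nonneg_left ((le_abs_self _).trans h3) h.δ_pos.le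
    _ = _ := by ring

/-- Half of ΔΓ(f) is the sum of the curvature defect and Γ(f, Δf + Kf), and both are of order ε. -/
theorem abs_lap_Gam_le (hε : 0 ≤ ε) (hεK : ε ≤ K) {f : V → ℝ} (hf : f ∈ E) (x : V) :
    |G.lap (G.Gam f f) x| ≤ 4 * (K + D) * δ * ε * G.normSq f := by
  have hδ := h.δ_pos
  have hs := G.normSq_nonneg f
  set r := √(δ * G.normSq f) with hr
  have hr2 : r * r = δ * G.normSq f := Real.mul_self_sqrt (by positivity)
  have hfb : ∀ y, |f y| ≤ r := fun y => Real.abs_le_sqrt (h.sq_le_normSq f y)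
  have hgb : ∀ y, |(G.lap f + K • f) y| ≤ ε * r := fun y => by
    apply abs_le_of_sq_le_sq _ (by positivity)
    have := h.lap_add_sq_le hf y
    simp only [Pi.add_apply, Pi.smul_apply, smul_eq_mul]
    nlinarith
  have h1 : |G.Gam f (G.lap f + K • f) x| ≤ 2 * D * δ * ε * G.normSq f := by
    have := covers_univ.abs_Gam_le (h.weightedDeg_le x)
      (f := f) (g := G.lap f + K • f) (a := 2 * r) (b := 2 * (ε * r))
      (fun y => by linarith [abs_sub (f y) (f x), hfb x, hfb y])
      (fun y => by
        linarith [abs_sub ((G.lap f + K • f) y) ((G.lap f + K • f) x), hgb x, hgb y])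
    calc _ ≤ _ := this
      _ = 2 * D * ε * (r * r) := by ring
      _ = _ := by rw [hr2]; ring
  have h2 : G.lap (G.Gam f f) x = 2 * (G.Gam2 f f x - K * G.Gam f f x)
      + 2 * G.Gam f (G.lap f + K • f) x := by
    rw [Gam2_self, covers_univ.Gam_add_right, covers_univ.Gam_smul_right]
    simp only [Pi.add_apply, Pi.smul_apply, smul_eq_mul]; ring
  have h3 := h.Gam2_le hε hεK hf x
  have h4 := h.curvature f x
  rw [abs_le] at h1 ⊢
  have h5 : 0 ≤ K * δ * ε * G.normSq f := by have := hε.trans hεK; positivity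
  rw [h2]
  constructor <;> nlinarith

/-- For g = Γ(f), the integrated curvature inequality converts the smallness of Δg into smallness of
Γ(g), and the oscillation bound applies to g. -/
theorem abs_Gam_sub_le (hD : 0 < D) (hK : 0 < K) (hε : 0 ≤ ε) (hεK : ε ≤ K) {n : ℝ}
    (hn : (Fintype.card V : ℝ) ≤ n) {f : V → ℝ} (hf : f ∈ E) (x y : V) :
    |G.Gam f f x - G.Gam f f y|
      ≤ 16 * (K + D) * δ ^ 2 * √(2 * D * n / K) / K * ε * G.normSq f := by
  have hδ := h.δ_pos
  have hs := G.normSq_nonneg f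
  have hn0 : 0 ≤ n := (Nat.cast_nonneg _).trans hn
  set η := 4 * (K + D) * δ * ε * G.normSq f with hη
  have hη0 : 0 ≤ η := by positivity
  have h1 : G.normSq (G.lap (G.Gam f f)) ≤ n * (δ * η ^ 2) := by
    calc G.normSq (G.lap (G.Gam f f)) ≤ ∑ _x : V, δ * η ^ 2 :=
          Finset.sum_le_sum fun z _ => mul_le_mul (h.m_le z)
            (sq_le_sq' (abs_le.mp (h.abs_lap_Gam_le hε hεK hf z)).1
              (abs_le.mp (h.abs_lap_Gam_le hε hεK hf z)).2) (sq_nonneg _) hδ.le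
      _ = Fintype.card V * (δ * η ^ 2) := by simp
      _ ≤ _ := mul_le_mul_of_nonneg_right hn (by positivity)
  have h2 : ∀ z, G.Gam (G.Gam f f) (G.Gam f f) z ≤ n * δ ^ 2 * η ^ 2 / K := fun z => by
    have e1 := le_mul_sum_of_nonneg h.one_le
      (g := G.Gam (G.Gam f f) (G.Gam f f)) (covers_univ.Gam_self_nonneg _) z
    have e2 := h.curvature.mul_sum_Gam_le (G.Gam f f)
    rw [le_div_iff₀ hK]
    calc _ ≤ (δ * ∑ z, G.m z * G.Gam (G.Gam f f) (G.Gam f f) z) * K :=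
          mul_le_mul_of_nonneg_right e1 hK.le
      _ = δ * (K * ∑ z, G.m z * G.Gam (G.Gam f f) (G.Gam f f) z) := by ring
      _ ≤ δ * (n * (δ * η ^ 2)) := mul_le_mul_of_nonneg_left (e2.trans h1) hδ.le
      _ = _ := by ring
  have h3 := covers_univ.abs_sub_le h.connected h.weightedDeg_le h.curvature hD hK h2 x y
  have h4 : √(2 * D * (n * δ ^ 2 * η ^ 2 / K)) = √(2 * D * n / K) * (δ * η) := by
    rw [show 2 * D * (n * δ ^ 2 * η ^ 2 / K) = (2 * D * n / K) * (δ * η) ^ 2 by ring,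
      Real.sqrt_mul (by positivity), Real.sqrt_sq (by positivity)]
  rw [h4] at h3
  refine h3.trans (le_of_eq ?_)
  rw [hη]; ring

theorem sum_Gam_ge (hε : 0 ≤ ε) {f : V → ℝ} (hf : f ∈ E) :
    (K - ε) * G.normSq f ≤ ∑ x, G.m x * G.Gam f f x := by
  have h1 := G.sum_m_mul_lap f f
  have h2 : ∑ x, G.m x * (f x * (G.lap f + K • f) x)
      = ∑ x, G.m x * (f x * G.lap f x) + K * G.normSq f := by
    rw [normSq, Finset.mul_sum, ← Finset.sum_add_distrib]
    refine Finset.sum_congr rfl fun y _ => ?_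
    simp only [Pi.add_apply, Pi.smul_apply, smul_eq_mul]; ring
  have h3 := abs_sum_mul_le (G := G) (f := f) (a := 1) (by norm_num) hε (G.normSq_nonneg f)
    (by simp) (h.normSq_le f hf)
  rw [h2, abs_le] at h3
  linarith

/-- The integral of Γ(f) is at least (K/2)‖f‖², and Γ(f) is almost constant, so no value of Γ(f) is
small. This permits errors relative to ‖f‖² to be restated relative to Γ(f) at any vertex. -/
theorem le_Gam {c n : ℝ} (hK : 0 < K) (hε : 0 ≤ ε) (hεK : 2 * ε ≤ K)
    (hn : (Fintype.card V : ℝ) ≤ n) {f : V → ℝ} (hf : f ∈ E)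
    (hc : ∀ x y, |G.Gam f f x - G.Gam f f y| ≤ c * ε * G.normSq f)
    (hcε : c * ε ≤ K / (4 * n * δ)) (y : V) :
    K / (4 * n * δ) * G.normSq f ≤ G.Gam f f y := by
  have hδ := h.δ_pos
  have hs := G.normSq_nonneg f
  have hn0 : 0 < n :=
    lt_of_lt_of_le (by have : Nonempty V := ⟨y⟩; exact_mod_cast Fintype.card_pos) hn
  have hΓ : ∀ z, G.Gam f f z ≤ G.Gam f f y + K / (4 * n * δ) * G.normSq f := fun z => by
    have h1 := (abs_le.mp (hc z y)).2
    have := mul_le_mul_of_nonneg_right hcε hs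
    linarith
  have h2 : ∑ x, G.m x * G.Gam f f x
      ≤ n * (δ * (G.Gam f f y + K / (4 * n * δ) * G.normSq f)) := by
    have h0 : 0 ≤ G.Gam f f y + K / (4 * n * δ) * G.normSq f :=
      add_nonneg (covers_univ.Gam_self_nonneg f y) (by positivity)
    calc _ ≤ ∑ _x : V, δ * (G.Gam f f y + K / (4 * n * δ) * G.normSq f) :=
          Finset.sum_le_sum fun z _ => mul_le_mul (h.m_le z) (hΓ z)
            (covers_univ.Gam_self_nonneg f z) hδ.le
      _ = Fintype.card V * (δ * (G.Gam f f y + K / (4 * n * δ) * G.normSq f)) := by simp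
      _ ≤ _ := mul_le_mul_of_nonneg_right hn (by positivity)
  have h3 := h.sum_Gam_ge hε hf
  have h4 : n * (δ * (G.Gam f f y + K / (4 * n * δ) * G.normSq f))
      = n * δ * G.Gam f f y + K / 4 * G.normSq f := by
    field_simp
  have h5 : K / 4 * G.normSq f ≤ n * δ * G.Gam f f y := by
    have : 2 * ε * G.normSq f ≤ K * G.normSq f := mul_le_mul_of_nonneg_right hεK hs
    linarith
  have h6 : K / (4 * n * δ) * G.normSq f = K / 4 * G.normSq f / (n * δ) := by
    field_simp
  rw [h6, div_le_iff₀ (by positivity)]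
  linarith

end NearExtremal

theorem exists_almostRigid {D K δ n : ℝ} (hD : 0 < D) (hK : 0 < K) (hδ : 0 < δ) (hn : 0 < n) :
    ∃ A ε₁ : ℝ, 0 < A ∧ 0 < ε₁ ∧ ∀ (V : Type*) [Fintype V] (G : WeightedGraph V)
      (E : Submodule ℝ (V → ℝ)) (ε : ℝ), (Fintype.card V : ℝ) ≤ n → 0 ≤ ε → ε ≤ ε₁ →
        G.NearExtremal D K δ ε E → G.AlmostRigid K A √ε E := by
  set a := 16 * (K + D) * δ ^ 2 * √(2 * D * n / K) / K with ha
  have ha0 : 0 ≤ a := by positivity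
  set c := K / (4 * n * δ) with hc
  have hc0 : 0 < c := by positivity
  -- The numerators a, δ and 2Kδ belong to the oscillation of Γ, the sup bounds on f and on Δf + Kf,
  -- and the curvature defect; dividing by c passes from ‖f‖² to Γ(f).
  refine ⟨(a + δ + 2 * K * δ) / c, min 1 (min (K / 2) (c / (a + 1))), by positivity,
    by positivity, ?_⟩
  intro V _ G E ε hcard hε hε1 h
  have e1 : ε ≤ 1 := hε1.trans (min_le_left _ _)
  have e2 : ε ≤ K / 2 := hε1.trans ((min_le_right _ _).trans (min_le_left _ _))
  have e3 : ε ≤ c / (a + 1) := hε1.trans ((min_le_right _ _).trans (min_le_right _ _))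
  have e4 : a * ε ≤ c := by
    rw [le_div_iff₀ (by positivity)] at e3; linarith
  have hosc := fun f (hf : f ∈ E) =>
    h.abs_Gam_sub_le hD hK hε (by linarith) hcard hf
  have hs : ∀ f ∈ E, ∀ y, G.normSq f ≤ G.Gam f f y / c := fun f hf y => by
    rw [le_div_iff₀ hc0, mul_comm]
    exact h.le_Gam hK hε (by linarith) hcard hf (hosc f hf) e4 y
  have key : ∀ f ∈ E, ∀ y, ∀ b t : ℝ, 0 ≤ b → 0 ≤ t → b ≤ a + δ + 2 * K * δ →
      b * t * G.normSq f ≤ (a + δ + 2 * K * δ) / c * t * G.Gam f f y := by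
    intro f hf y b t hb ht hbA
    calc b * t * G.normSq f ≤ (a + δ + 2 * K * δ) * t * (G.Gam f f y / c) :=
          mul_le_mul (mul_le_mul_of_nonneg_right hbA ht) (hs f hf y) (G.normSq_nonneg f)
            (by positivity)
      _ = _ := by ring
  have hKδ : 0 < 2 * K * δ := by positivity
  rw [← Real.sq_sqrt hε] at hosc
  refine ⟨fun f hf x y => ?_, fun f hf x y => ?_, fun f hf x y => ?_, fun f hf x y => ?_⟩
  · have := (abs_le.mp (hosc f hf y x)).2
    have := key f hf x a (√ε ^ 2) ha0 (by positivity) (by linarith)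
    linarith
  · have := h.sq_le_normSq f x
    have := key f hf y δ 1 hδ.le one_pos.le (by linarith)
    linarith
  · have h1 := h.lap_add_sq_le hf x
    have h2 := key f hf y δ (√ε ^ 2) hδ.le (by positivity) (by linarith)
    rw [Real.sq_sqrt hε] at h2 ⊢
    -- This bound is quadratic in ε. Weakening it to linear order costs nothing, since the final
    -- rate is √ε.
    have h3 : δ * ε ^ 2 * G.normSq f ≤ δ * ε * G.normSq f :=
      mul_le_mul_of_nonneg_right (mul_le_mul_of_nonneg_left (by nlinarith) hδ.le)
        (G.normSq_nonneg f)
    linarith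
  · have h1 := h.Gam2_le hε (by linarith) hf x
    have h2 := key f hf y (2 * K * δ) (√ε ^ 2) (by positivity) (by positivity) (by linarith)
    rw [Real.sq_sqrt hε] at h2 ⊢
    linarith

end Finite

/-! ### Variation of the measure along paths and the two-step curvature inequality. -/

theorem abs_m_sub_le {b : ℝ} (hconn : G.toSimpleGraph.Connected)
    (h : ∀ x y, G.toSimpleGraph.Adj x y → |G.m x - G.m y| ≤ b) (x y : V) :
    |G.m x - G.m y| ≤ G.toSimpleGraph.dist x y * b := by
  obtain ⟨q, hq⟩ := (hconn.preconnected x y).exists_walk_length_eq_dist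
  rw [← hq]
  clear hq
  induction q with
  | nil => simp
  | cons hab q ih =>
    refine (abs_sub_le _ _ _).trans ((add_le_add (h _ _ hab) ih).trans (le_of_eq ?_))
    rw [SimpleGraph.Walk.length_cons]; push_cast; ring

theorem Covers.rate_le {N : V → Finset V} (hN : G.Covers N) {D : ℝ}
    (hD : ∀ x, G.weightedDeg x ≤ D) (x y : V) : G.rate x y ≤ D := by
  rcases eq_or_ne (G.rate x y) 0 with h0 | h0
  · rw [h0]
    refine le_trans ?_ (hD x)
    rw [hN.weightedDeg_eq]
    exact Finset.sum_nonneg fun y _ => rate_nonneg x y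
  · refine le_trans ?_ (hD x)
    rw [hN.weightedDeg_eq]
    exact Finset.single_le_sum (f := fun y => G.rate x y) (fun y _ => rate_nonneg x y)
      (hN.mem_of_adj (adj_of_rate_ne_zero h0))

/-- If `u` and `v` are at distance at least two, the curvature defect at `u` controls the
deviation from the mean value identity along two-step paths from `u` to `v`. -/
theorem CDInfty.sum_rate_mul_rate_sq_le [Fintype V] {K : ℝ} (hCD : G.CDInfty K)
    {u v : V} (huv : u ≠ v) (hadj : ¬ G.toSimpleGraph.Adj u v) (f : V → ℝ) :
    (∑ y, G.rate u y * G.rate y v * (f v - 2 * f y + f u)) ^ 2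
      ≤ 4 * (∑ y, G.rate u y * G.rate y v) * (G.Gam2 f f u - K * G.Gam f f u) := by
  classical
  have huv0 : G.rate u v = 0 := by
    by_contra h0; exact hadj (adj_of_rate_ne_zero h0)
  -- Γ₂ - KΓ is a nonnegative quadratic form at u, tested on f + tχ. Since v is not adjacent to u,
  -- Γ(·, χ)(u) = 0 and the new terms involve only two-step paths from u to v.
  set χ : V → ℝ := Pi.single v 1 with hχ
  have hχv : χ v = 1 := Pi.single_eq_same v 1
  have hχn : ∀ y, y ≠ v → χ y = 0 := fun y hy => Pi.single_eq_of_ne hy 1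
  have hχr : ∀ y, G.rate u y * χ y = 0 := fun y => by
    rcases eq_or_ne y v with rfl | hy
    · rw [huv0, zero_mul]
    · rw [hχn y hy, mul_zero]
  have hχu := hχn u huv
  have hsum : ∀ (y : V) (g : V → ℝ), ∑ z, G.rate y z * (χ z * g z) = G.rate y v * g v := by
    intro y g
    rw [Finset.sum_eq_single v (fun z _ hz => by rw [hχn z hz]; ring) (by simp), hχv, one_mul]
  have hΓ0 : ∀ g, G.Gam g χ u = 0 := fun g => by
    rw [covers_univ.Gam_eq, Finset.sum_eq_zero, mul_zero]
    intro y _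
    rw [hχu, sub_zero, mul_left_comm, hχr, mul_zero]
  have hΓ1 : ∀ g y, y ≠ v → G.Gam g χ y = 1 / 2 * (G.rate y v * (g v - g y)) := by
    intro g y hy
    rw [covers_univ.Gam_eq, ← hsum y fun z => g z - g y]
    congr 1
    exact Finset.sum_congr rfl fun z _ => by rw [hχn y hy]; ring
  have hlapχ : ∀ y, y ≠ v → G.lap χ y = G.rate y v := by
    intro y hy
    have := hsum y 1
    simp only [Pi.one_apply, mul_one] at this
    rw [covers_univ.lap_eq, ← this]
    exact Finset.sum_congr rfl fun z _ => by rw [hχn y hy, sub_zero]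
  have hlapu : G.lap χ u = 0 := by rw [hlapχ u huv, huv0]
  have hlapΓ : ∀ g, G.lap (G.Gam g χ) u
      = 1 / 2 * ∑ y, G.rate u y * G.rate y v * (g v - g y) := by
    intro g
    rw [covers_univ.lap_eq, Finset.mul_sum]
    refine Finset.sum_congr rfl fun y _ => ?_
    rw [hΓ0]
    rcases eq_or_ne y v with rfl | hy
    · rw [huv0]; ring
    · rw [hΓ1 g y hy]; ring
  have hΓlap : ∀ g, G.Gam g (G.lap χ) u
      = 1 / 2 * ∑ y, G.rate u y * G.rate y v * (g y - g u) := by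
    intro g
    rw [covers_univ.Gam_eq]
    congr 1
    refine Finset.sum_congr rfl fun y _ => ?_
    rcases eq_or_ne y v with rfl | hy
    · rw [huv0]; ring
    · rw [hlapu, hlapχ y hy]; ring
  set S := ∑ y, G.rate u y * G.rate y v * (f v - 2 * f y + f u) with hS
  set W := ∑ y, G.rate u y * G.rate y v with hW
  have hfχ : G.lap (G.Gam f χ) u - G.Gam f (G.lap χ) u = 1 / 2 * S := by
    rw [hlapΓ, hΓlap, ← mul_sub, ← Finset.sum_sub_distrib]
    congr 1
    exact Finset.sum_congr rfl fun y _ => by ring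
  have hχχ1 : G.lap (G.Gam χ χ) u = 1 / 2 * W := by
    rw [hlapΓ]
    congr 1
    refine Finset.sum_congr rfl fun y _ => ?_
    rw [hχv, mul_sub, mul_one, mul_right_comm, hχr, zero_mul, sub_zero]
  have hχχ2 : G.Gam χ (G.lap χ) u = 0 := by
    rw [hΓlap, Finset.sum_eq_zero, mul_zero]
    intro y _
    rw [hχu, sub_zero, mul_right_comm, hχr, zero_mul]
  -- The discriminant of this polynomial in t is the asserted bound.
  have hq : ∀ t : ℝ, 0 ≤ W / 4 * (t * t) + S / 2 * t
      + (G.Gam2 f f u - K * G.Gam f f u) := by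
    intro t
    have h := hCD (f + t • χ) u
    have e1 : G.Gam (f + t • χ) (f + t • χ)
        = G.Gam f f + (2 * t) • G.Gam f χ + (t ^ 2) • G.Gam χ χ := by
      simp only [covers_univ.Gam_add_left, covers_univ.Gam_add_right, covers_univ.Gam_smul_left,
        covers_univ.Gam_smul_right, covers_univ.Gam_comm χ f, smul_smul]
      funext z
      simp only [Pi.add_apply, Pi.smul_apply, smul_eq_mul]; ring
    have e2 : G.Gam2 (f + t • χ) (f + t • χ) u = G.Gam2 f f u + S / 2 * t + W / 4 * (t * t) := by
      rw [Gam2_self, Gam2_self, e1]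
      simp only [covers_univ.lap_add, covers_univ.lap_smul, covers_univ.Gam_add_left,
        covers_univ.Gam_add_right, covers_univ.Gam_smul_left, covers_univ.Gam_smul_right,
        Pi.add_apply, Pi.smul_apply, smul_eq_mul, hχχ1, hχχ2, covers_univ.Gam_comm χ (G.lap f),
        hΓ0]
      linear_combination t * hfχ
    rw [e2, e1] at h
    simp only [Pi.add_apply, Pi.smul_apply, smul_eq_mul, hΓ0] at h
    linarith
  have := discrim_le_zero hq
  rw [discrim] at this
  nlinarith

/-! ### Local structure: degrees, rates and measure. -/

namespace AlmostRigid

variable {K A σ D : ℝ} {E : Submodule ℝ (V → ℝ)} {N : V → Finset V} {d : ℕ}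
  (h : G.AlmostRigid K A σ E)
include h

theorem eq_zero_of_Gam_eq_zero {f : V → ℝ} (hf : f ∈ E) {x : V} (h0 : G.Gam f f x = 0) :
    f = 0 := by
  funext y
  have := h.sq_le f hf y x
  rw [h0, mul_zero] at this
  exact pow_eq_zero_iff (two_ne_zero) |>.mp (le_antisymm this (sq_nonneg _))

theorem abs_lap_add_le (hA : 0 < A) (hσ : 0 ≤ σ) (hD0 : 0 ≤ D) {f : V → ℝ} (hf : f ∈ E) {x : V}
    (hx : G.Gam f f x ≤ D) (y : V) : |G.lap f y + K * f y| ≤ √(A * D) * σ := by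
  apply abs_le_of_sq_le_sq _ (by positivity)
  rw [mul_pow, Real.sq_sqrt (by positivity)]
  calc _ ≤ _ := h.lap_le f hf y x
    _ ≤ A * σ ^ 2 * D := mul_le_mul_of_nonneg_left hx (by positivity)
    _ = _ := by ring

/-- The gradient of an edge function at the far end of its edge. -/
theorem rate_add_sum_le [DecidableEq V] (hN : G.Covers N) {x y : V} {f : V → ℝ} (hf : f ∈ E)
    (hxy : G.toSimpleGraph.Adj x y) (h1 : f y - f x = 1) (h2 : G.Gam f f x = G.rate x y / 2) :
    G.rate y x + ∑ z ∈ (N y).erase x, G.rate y z * (f z - f y) ^ 2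
      ≤ G.rate x y + A * σ ^ 2 * G.rate x y := by
  have e := h.Gam_le f hf x y
  rw [h2, hN.Gam_eq, ← Finset.add_sum_erase _ _ (hN.mem_of_adj hxy.symm)] at e
  have h3 : f x - f y = -1 := by linarith
  rw [h3] at e
  have h4 : ∑ z ∈ (N y).erase x, G.rate y z * (f z - f y) ^ 2
      = ∑ z ∈ (N y).erase x, G.rate y z * ((f z - f y) * (f z - f y)) :=
    Finset.sum_congr rfl fun z _ => by ring
  rw [h4]
  linarith

variable [Fintype V]

/-- Gradients at a vertex can be prescribed within `E`, which forces the degree to be maximal. -/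
theorem card_eq_and_exists_gradient (hN : G.Covers N) (hcard : ∀ x, (N x).card ≤ d)
    (hE : Module.finrank ℝ E = d) (x : V) :
    (N x).card = d ∧ ∀ t : V → ℝ, ∃ f ∈ E, ∀ y ∈ N x, f y - f x = t y := by
  let L : E →ₗ[ℝ] (N x → ℝ) :=
    { toFun := fun f y => f.1 y - f.1 x
      map_add' := fun f g => by funext y; simp only [Submodule.coe_add, Pi.add_apply]; ring
      map_smul' := fun c f => by
        funext y; simp only [Submodule.coe_smul, Pi.smul_apply, smul_eq_mul, RingHom.id_apply]
        ring }
  have hinj : Function.Injective L := by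
    -- A vanishing gradient at x gives Γ(f)(x) = 0, and Γ(f)(x) controls f everywhere.
    rw [injective_iff_map_eq_zero]
    intro f hf
    refine Subtype.ext (h.eq_zero_of_Gam_eq_zero f.2 (x := x) ?_)
    rw [hN.Gam_eq, Finset.sum_eq_zero, mul_zero]
    intro y hy
    have : f.1 y - f.1 x = 0 := congrFun hf ⟨y, hy⟩
    rw [this]; ring
  have hle := LinearMap.finrank_le_finrank_of_injective hinj
  rw [hE, Module.finrank_fintype_fun_eq_card, Fintype.card_coe] at hle
  have hc : (N x).card = d := le_antisymm (hcard x) hle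
  refine ⟨hc, fun t => ?_⟩
  have hsurj := (LinearMap.injective_iff_surjective_of_finrank_eq_finrank (f := L) (by
    rw [hE, Module.finrank_fintype_fun_eq_card, Fintype.card_coe, hc])).mp hinj
  obtain ⟨f, hf⟩ := hsurj fun y => t y
  exact ⟨f.1, f.2, fun y hy => congrFun hf ⟨y, hy⟩⟩

/-- A function in `E` whose gradient at `x` is concentrated on the edge to `y`. -/
theorem exists_edge_function (hN : G.Covers N) (hcard : ∀ x, (N x).card ≤ d)
    (hE : Module.finrank ℝ E = d) {x y : V} (hxy : G.toSimpleGraph.Adj x y) :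
    ∃ f ∈ E, f y - f x = 1 ∧ G.Gam f f x = G.rate x y / 2 ∧ G.lap f x = G.rate x y := by
  classical
  obtain ⟨f, hf, hg⟩ := (h.card_eq_and_exists_gradient hN hcard hE x).2 (Pi.single y 1)
  have hy := hN.mem_of_adj hxy
  refine ⟨f, hf, by simpa using hg y hy, ?_, ?_⟩
  · rw [hN.Gam_eq, Finset.sum_eq_single y _ (absurd hy), hg y hy]
    · simp; ring
    · intro z hz hne
      rw [hg z hz, Pi.single_eq_of_ne hne]; ring
  · rw [hN.lap_eq, Finset.sum_eq_single y _ (absurd hy), hg y hy]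
    · simp
    · intro z hz hne
      rw [hg z hz, Pi.single_eq_of_ne hne]; ring

/-- For the edge function, f(x)² and f(y)² are at most A times half the rate, yet f(y) - f(x) = 1.
-/
theorem one_le_rate (hN : G.Covers N) (hcard : ∀ x, (N x).card ≤ d)
    (hE : Module.finrank ℝ E = d) {x y : V} (hxy : G.toSimpleGraph.Adj x y) :
    1 ≤ 2 * A * G.rate x y := by
  obtain ⟨f, hf, h1, h2, -⟩ := h.exists_edge_function hN hcard hE hxy
  have e1 := h.sq_le f hf x x
  have e2 := h.sq_le f hf y x
  rw [h2] at e1 e2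
  nlinarith [sq_nonneg (f y + f x)]

/-- The edge function has Γ equal to half the rate from x to y at x, and at least half the rate of
the return edge at y; Γ is almost constant. -/
theorem rate_le_rate (hA : 0 < A) (hN : G.Covers N) (hcard : ∀ x, (N x).card ≤ d)
    (hE : Module.finrank ℝ E = d) (hD : ∀ x, G.weightedDeg x ≤ D) {x y : V}
    (hxy : G.toSimpleGraph.Adj x y) : G.rate y x ≤ G.rate x y + A * σ ^ 2 * D := by
  classical
  obtain ⟨f, hf, h1, h2, -⟩ := h.exists_edge_function hN hcard hE hxy
  have e1 := h.rate_add_sum_le hN hf hxy h1 h2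
  have e2 : 0 ≤ ∑ z ∈ (N y).erase x, G.rate y z * (f z - f y) ^ 2 :=
    Finset.sum_nonneg fun z _ => mul_nonneg (rate_nonneg y z) (sq_nonneg _)
  have e3 : A * σ ^ 2 * G.rate x y ≤ A * σ ^ 2 * D :=
    mul_le_mul_of_nonneg_left (hN.rate_le hD x y) (by positivity)
  linarith

theorem abs_rate_sub_rate_le (hA : 0 < A) (hN : G.Covers N) (hcard : ∀ x, (N x).card ≤ d)
    (hE : Module.finrank ℝ E = d) (hD : ∀ x, G.weightedDeg x ≤ D) {x y : V}
    (hxy : G.toSimpleGraph.Adj x y) : |G.rate y x - G.rate x y| ≤ A * σ ^ 2 * D := by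
  have e1 := h.rate_le_rate hA hN hcard hE hD hxy
  have e2 := h.rate_le_rate hA hN hcard hE hD hxy.symm
  rw [abs_le]
  constructor <;> linarith

/-- Reversibility m(x)·rate(x,y) = m(y)·rate(y,x) transfers the near symmetry of the rates, which
are bounded below, to m. -/
theorem abs_m_sub_le_of_adj {δ : ℝ} (hA : 0 < A) (hN : G.Covers N)
    (hcard : ∀ x, (N x).card ≤ d) (hE : Module.finrank ℝ E = d)
    (hD : ∀ x, G.weightedDeg x ≤ D) (hδ : ∀ x, G.m x ≤ δ) {x y : V}
    (hxy : G.toSimpleGraph.Adj x y) :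
    |G.m x - G.m y| ≤ 2 * A ^ 2 * D * δ * σ ^ 2 := by
  have e1 := h.abs_rate_sub_rate_le hA hN hcard hE hD hxy
  have e2 := h.one_le_rate hN hcard hE hxy
  have e3 : (G.m x - G.m y) * G.rate x y = G.m y * (G.rate y x - G.rate x y) := by
    linear_combination m_mul_rate_comm (G := G) x y
  calc |G.m x - G.m y| ≤ |G.m x - G.m y| * (2 * A * G.rate x y) :=
        le_mul_of_one_le_right (abs_nonneg _) e2
    _ = 2 * A * |(G.m x - G.m y) * G.rate x y| := by
        rw [abs_mul, abs_of_nonneg (rate_nonneg x y)]; ring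
    _ = 2 * A * (G.m y * |G.rate y x - G.rate x y|) := by
        rw [e3, abs_mul, abs_of_pos (G.m_pos y)]
    _ ≤ 2 * A * (δ * (A * σ ^ 2 * D)) := by
        have := mul_le_mul (hδ y) e1 (abs_nonneg _) ((G.m_pos y).le.trans (hδ y))
        exact mul_le_mul_of_nonneg_left this (by positivity)
    _ = _ := by ring

/-- Subtracting the almost-eigenfunction relations for the edge function at y and at x gives
rate(x,y) + rate(y,x) ≈ K, and the two rates nearly agree. -/
theorem abs_rate_sub_le (hA : 0 < A) (hσ : 0 ≤ σ) (hσ1 : σ ≤ 1) (hN : G.Covers N)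
    (hcard : ∀ x, (N x).card ≤ d) (hE : Module.finrank ℝ E = d)
    (hD : ∀ x, G.weightedDeg x ≤ D) (hD0 : 0 ≤ D) {x y : V} (hxy : G.toSimpleGraph.Adj x y) :
    |G.rate x y - K / 2| ≤ (√(A * D) + D * √(2 * A) + A * D) * σ := by
  classical
  obtain ⟨f, hf, h1, h2, h3⟩ := h.exists_edge_function hN hcard hE hxy
  have hr := hN.rate_le hD x y
  have hr0 := G.rate_nonneg x y
  have hΓ : G.Gam f f x ≤ D := by rw [h2]; linarith
  have e1 := h.abs_lap_add_le hA hσ hD0 hf hΓ x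
  have e2 := h.abs_lap_add_le hA hσ hD0 hf hΓ y
  set R := ∑ z ∈ (N y).erase x, G.rate y z * (f z - f y) ^ 2 with hR
  set r := ∑ z ∈ (N y).erase x, G.rate y z * (f z - f y) with hrdef
  have e3 := h.rate_add_sum_le hN hf hxy h1 h2
  have e4 := h.rate_le_rate hA hN hcard hE hD hxy.symm
  -- The return edge already accounts for almost the whole gradient at y, so little is left for the
  -- other edges; Cauchy–Schwarz then makes their contribution r to Δf(y) small.
  have e5 : R ≤ 2 * A * D * σ ^ 2 := by
    have : A * σ ^ 2 * G.rate x y ≤ A * σ ^ 2 * D :=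
      mul_le_mul_of_nonneg_left hr (by positivity)
    linarith
  have e6 : r ^ 2 ≤ D * R := by
    have hs : ∑ z ∈ (N y).erase x, G.rate y z ≤ D := by
      refine le_trans ?_ (hD y)
      rw [hN.weightedDeg_eq]
      exact Finset.sum_le_sum_of_subset_of_nonneg (Finset.erase_subset _ _)
        fun z _ _ => rate_nonneg y z
    have hR0 : 0 ≤ R :=
      Finset.sum_nonneg fun z _ => mul_nonneg (rate_nonneg y z) (sq_nonneg _)
    calc r ^ 2 ≤ (∑ z ∈ (N y).erase x, G.rate y z) * R := by
          refine Finset.sum_sq_le_sum_mul_sum_of_sq_le_mul _ (fun z _ => rate_nonneg y z)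
            (fun z _ => mul_nonneg (rate_nonneg y z) (sq_nonneg _))
            fun z _ => le_of_eq (by ring)
      _ ≤ D * R := mul_le_mul_of_nonneg_right hs hR0
  have e7 : |r| ≤ D * √(2 * A) * σ := by
    apply abs_le_of_sq_le_sq _ (by positivity)
    rw [mul_pow, mul_pow, Real.sq_sqrt (by positivity)]
    calc r ^ 2 ≤ D * (2 * A * D * σ ^ 2) := e6.trans (mul_le_mul_of_nonneg_left e5 hD0)
      _ = _ := by ring
  have e8 : G.lap f y = -G.rate y x + r := by
    rw [hN.lap_eq, ← Finset.add_sum_erase _ _ (hN.mem_of_adj hxy.symm),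
      show f x - f y = -1 by linarith]
    ring
  have e9 := h.abs_rate_sub_rate_le hA hN hcard hE hD hxy
  have e10 : A * σ ^ 2 * D ≤ A * D * σ := by
    have : A * D * (σ ^ 2) ≤ A * D * σ :=
      mul_le_mul_of_nonneg_left (by nlinarith) (by positivity)
    linarith
  have hKf : K * f y = K * f x + K := by
    have : f y = f x + 1 := by linarith
    rw [this]; ring
  rw [e8, hKf] at e2
  rw [h3] at e1
  rw [abs_le] at *
  have e11 : 0 ≤ √(A * D) * σ := by positivity
  have e12 : 0 ≤ D * √(2 * A) * σ := by positivity
  have e13 : 0 ≤ A * D * σ := by positivity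
  constructor <;> linarith [e1.1, e1.2, e2.1, e2.2, e7.1, e7.2, e9.1, e9.2]

/-! ### Affine growth of functions in E and comparison with the distance. -/

/-- Approximately affine growth along geodesics propagates from one vertex to the next. -/
theorem abs_sub_sub_two_le (hA : 0 < A) (hσ : 0 ≤ σ) (hN : G.Covers N)
    (hcard : ∀ x, (N x).card ≤ d) (hE : Module.finrank ℝ E = d)
    (hCD : G.CDInfty K) (hD0 : 0 ≤ D) {f : V → ℝ} (hf : f ∈ E) {x : V} (hx : G.Gam f f x ≤ D)
    {u v : V} (huv : G.toSimpleGraph.dist u v = 2) {η : ℝ}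
    (hη : ∀ y, G.toSimpleGraph.Adj u y → G.toSimpleGraph.Adj y v → |f y - f u - 1| ≤ η) :
    |f v - f u - 2| ≤ 4 * A * √(A * D) * σ + 2 * η := by
  have hne : u ≠ v := by rintro rfl; simp at huv
  have hnadj : ¬ G.toSimpleGraph.Adj u v := fun hadj => by
    rw [← SimpleGraph.dist_eq_one_iff_adj] at hadj; omega
  obtain ⟨z, huz, hzv⟩ : ∃ z, G.toSimpleGraph.Adj u z ∧ G.toSimpleGraph.Adj z v := by
    have hr : G.toSimpleGraph.Reachable u v := by
      by_contra hn; rw [SimpleGraph.dist_eq_zero_of_not_reachable hn] at huv; omega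
    obtain ⟨q, hq⟩ := hr.exists_walk_length_eq_dist
    rw [huv] at hq
    cases q with
    | nil => simp at hq
    | cons h1 q =>
      cases q with
      | nil => simp at hq
      | cons h2 q =>
        cases q with
        | nil => exact ⟨_, h1, h2⟩
        | cons h3 q => simp at hq
  have hη0 : 0 ≤ η := (abs_nonneg _).trans (hη z huz hzv)
  have hS := hCD.sum_rate_mul_rate_sq_le hne hnadj f
  set S := ∑ y, G.rate u y * G.rate y v * (f v - 2 * f y + f u) with hSdef
  set W := ∑ y, G.rate u y * G.rate y v with hW
  have hnn : ∀ y, 0 ≤ G.rate u y * G.rate y v := fun y =>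
    mul_nonneg (rate_nonneg _ _) (rate_nonneg _ _)
  -- The discriminant bound is of order √W. Some two-step path has weight at least (2A)⁻², so √W is
  -- at most 2A·W, and W can be divided out at the end.
  have hW1 : 1 ≤ (2 * A) ^ 2 * W := by
    have h1 := h.one_le_rate hN hcard hE huz
    have h2 := h.one_le_rate hN hcard hE hzv
    calc (1 : ℝ) ≤ (2 * A * G.rate u z) * (2 * A * G.rate z v) :=
          one_le_mul_of_one_le_of_one_le h1 h2
      _ = (2 * A) ^ 2 * (G.rate u z * G.rate z v) := by ring
      _ ≤ (2 * A) ^ 2 * W := mul_le_mul_of_nonneg_left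
          (Finset.single_le_sum (f := fun y => G.rate u y * G.rate y v) (fun y _ => hnn y)
            (Finset.mem_univ z)) (by positivity)
  have hW0 : 0 < W := by
    by_contra hn
    nlinarith [mul_nonneg (sq_nonneg (2 * A)) (not_lt.mp hn |> neg_nonneg.mpr)]
  have hS2 : |S| ≤ 4 * A * √(A * D) * σ * W := by
    apply abs_le_of_sq_le_sq _ (by positivity)
    have h1 : G.Gam2 f f u - K * G.Gam f f u ≤ A * σ ^ 2 * D := by
      have := h.Gam2_le f hf u x
      have := mul_le_mul_of_nonneg_left hx (by positivity : 0 ≤ A * σ ^ 2)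
      linarith
    calc S ^ 2 ≤ 4 * W * (A * σ ^ 2 * D) :=
          hS.trans (mul_le_mul_of_nonneg_left h1 (by positivity))
      _ ≤ 4 * W * (A * σ ^ 2 * D) * ((2 * A) ^ 2 * W) :=
          le_mul_of_one_le_right (by positivity) hW1
      _ = (4 * A * σ * W) ^ 2 * (A * D) := by ring
      _ = (4 * A * σ * W) ^ 2 * √(A * D) ^ 2 := by rw [Real.sq_sqrt (by positivity)]
      _ = _ := by ring
  have hT : |∑ y, G.rate u y * G.rate y v * (f y - f u - 1)| ≤ W * η := by
    rw [hW, Finset.sum_mul]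
    refine (Finset.abs_sum_le_sum_abs _ _).trans (Finset.sum_le_sum fun y _ => ?_)
    rw [abs_mul, abs_of_nonneg (hnn y)]
    rcases eq_or_ne (G.rate u y * G.rate y v) 0 with h0 | h0
    · simp [h0]
    · exact mul_le_mul_of_nonneg_left (hη y (adj_of_rate_ne_zero (left_ne_zero_of_mul h0))
        (adj_of_rate_ne_zero (right_ne_zero_of_mul h0))) (hnn y)
  -- Averages f(v) - f(u) - 2 = (f(v) - 2f(y) + f(u)) + 2(f(y) - f(u) - 1) over the midpoints y.
  have hid : W * (f v - f u - 2)
      = S + 2 * ∑ y, G.rate u y * G.rate y v * (f y - f u - 1) := by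
    rw [hW, hSdef, Finset.sum_mul, Finset.mul_sum, ← Finset.sum_add_distrib]
    exact Finset.sum_congr rfl fun y _ => by ring
  have hfin : W * |f v - f u - 2| ≤ W * (4 * A * √(A * D) * σ + 2 * η) := by
    calc W * |f v - f u - 2| = |W * (f v - f u - 2)| := by rw [abs_mul, abs_of_pos hW0]
      _ ≤ |S| + 2 * |∑ y, G.rate u y * G.rate y v * (f y - f u - 1)| := by
          rw [hid]
          refine (abs_add_le _ _).trans (le_of_eq ?_)
          rw [abs_mul, abs_of_pos (by norm_num : (0 : ℝ) < 2)]
      _ ≤ _ := by linarith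
  exact le_of_mul_le_mul_left hfin hW0

theorem abs_sub_sub_dist_le (hA : 0 < A) (hσ : 0 ≤ σ) (hN : G.Covers N)
    (hcard : ∀ x, (N x).card ≤ d) (hE : Module.finrank ℝ E = d)
    (hconn : G.toSimpleGraph.Connected)
    (hCD : G.CDInfty K) (hD0 : 0 ≤ D) {f : V → ℝ} (hf : f ∈ E) {x : V} (hx : G.Gam f f x ≤ D)
    (hgrad : ∀ y, G.toSimpleGraph.Adj x y → f y - f x = 1) (n : ℕ) :
    ∀ v, G.toSimpleGraph.dist x v = n → |f v - f x - n| ≤ 5 ^ n * (4 * A * √(A * D) * σ) := by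
  set b := 4 * A * √(A * D) * σ with hb
  have hb0 : 0 ≤ b := by positivity
  induction n using Nat.strong_induction_on with
  | _ n ih =>
    intro v hv
    match n, ih, hv with
    | 0, _, hv =>
      rw [(hconn.dist_eq_zero_iff).mp hv]
      simpa using hb0
    | 1, _, hv =>
      rw [hgrad v (SimpleGraph.dist_eq_one_iff_adj.mp hv)]
      simpa using hb0
    | n + 2, ih, hv =>
      obtain ⟨q, hq⟩ := (hconn.preconnected v x).exists_walk_length_eq_dist
      rw [SimpleGraph.dist_comm, hv] at hq
      obtain ⟨u, hxu, huv⟩ : ∃ u, G.toSimpleGraph.dist x u = n ∧ G.toSimpleGraph.dist u v = 2 := by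
        cases q with
        | nil => simp at hq
        | cons h1 q =>
          cases q with
          | nil => simp at hq
          | cons h2 q =>
            rename_i y u
            simp only [SimpleGraph.Walk.length_cons] at hq
            have a1 := SimpleGraph.dist_le q
            have a2 := SimpleGraph.dist_le (h1.toWalk.append h2.toWalk)
            have a3 := hconn.dist_triangle (u := x) (v := u) (w := v)
            rw [SimpleGraph.dist_comm] at a1 a2
            simp only [SimpleGraph.Walk.length_append, SimpleGraph.Walk.length_cons,
              SimpleGraph.Walk.length_nil] at a2
            exact ⟨u, by omega, by omega⟩
      -- With errors 5ⁿb and 5ⁿ⁺¹b at distances n and n + 1, the next error is at most b + (3 +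
      -- 10)·5ⁿb ≤ 14·5ⁿb, which is below 5ⁿ⁺²b.
      have h1 := ih n (by omega) u hxu
      have h2 := h.abs_sub_sub_two_le hA hσ hN hcard hE hCD hD0 hf hx huv
        (η := 5 ^ (n + 1) * b + 5 ^ n * b) fun y huy hyv => by
          have a1 := hconn.dist_triangle (u := x) (v := u) (w := y)
          have a2 := hconn.dist_triangle (u := x) (v := y) (w := v)
          rw [SimpleGraph.dist_eq_one_iff_adj.mpr huy] at a1
          rw [SimpleGraph.dist_eq_one_iff_adj.mpr hyv] at a2
          have h3 := ih (n + 1) (by omega) y (by omega)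
          rw [abs_le] at *
          push_cast at h3
          constructor <;> linarith [h1.1, h1.2, h3.1, h3.2]
      have h5 : (1 : ℝ) ≤ 5 ^ n := one_le_pow₀ (by norm_num)
      have h6 : b ≤ 5 ^ n * b := le_mul_of_one_le_left hb0 h5
      rw [← hb] at h2
      rw [abs_le] at *
      push_cast
      rw [pow_succ] at h2
      rw [pow_add]
      constructor <;> linarith [h1.1, h1.2, h2.1, h2.2]

/-- The distance function is almost affine over `E`. -/
theorem exists_abs_distFrom_sub_le (hA : 0 < A) (hσ : 0 ≤ σ) (hσ1 : σ ≤ 1) (hN : G.Covers N)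
    (hcard : ∀ x, (N x).card ≤ d) (hadj : ∀ x, ∀ y ∈ N x, G.toSimpleGraph.Adj x y)
    (hE : Module.finrank ℝ E = d)
    (hconn : G.toSimpleGraph.Connected) (hD : ∀ x, G.weightedDeg x ≤ D)
    (hCD : G.CDInfty K) (hD0 : 0 ≤ D) (hK : 0 < K) {L : ℕ}
    (hL : ∀ x y, G.toSimpleGraph.dist x y ≤ L) (x : V) :
    ∃ f ∈ E, ∀ v, |G.distFrom x v - d / 2 - f v| ≤
      (5 ^ L * (4 * A * √(A * D)) +
        (√(A * D) + d * (√(A * D) + D * √(2 * A) + A * D)) / K) * σ := by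
  obtain ⟨hc, hex⟩ := h.card_eq_and_exists_gradient hN hcard hE x
  obtain ⟨f, hf, hg⟩ := hex fun _ => 1
  have hdeg : 0 ≤ G.weightedDeg x := by
    rw [hN.weightedDeg_eq]; exact Finset.sum_nonneg fun y _ => rate_nonneg x y
  have hΓ : G.Gam f f x ≤ D := by
    rw [hN.Gam_eq, Finset.sum_congr rfl fun y hy => by rw [hg y hy]]
    simp only [mul_one, ← hN.weightedDeg_eq]
    linarith [hD x]
  have hlap : G.lap f x = G.weightedDeg x := by
    rw [hN.lap_eq, hN.weightedDeg_eq]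
    exact Finset.sum_congr rfl fun y hy => by rw [hg y hy, mul_one]
  have h1 := h.abs_lap_add_le hA hσ hD0 hf hΓ x
  rw [hlap] at h1
  set c := √(A * D) + D * √(2 * A) + A * D with hc_def
  have h2 : |G.weightedDeg x - d * (K / 2)| ≤ d * (c * σ) := by
    have : G.weightedDeg x - d * (K / 2) = ∑ y ∈ N x, (G.rate x y - K / 2) := by
      rw [Finset.sum_sub_distrib, ← hN.weightedDeg_eq, Finset.sum_const, hc, nsmul_eq_mul]
    rw [this]
    calc _ ≤ ∑ y ∈ N x, |G.rate x y - K / 2| := Finset.abs_sum_le_sum_abs _ _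
      _ ≤ ∑ _y ∈ N x, c * σ := Finset.sum_le_sum fun y hy =>
          h.abs_rate_sub_le hA hσ hσ1 hN hcard hE hD hD0 (hadj x y hy)
      _ = _ := by rw [Finset.sum_const, hc, nsmul_eq_mul]
  -- The shift d/2 arises here: -Kf(x) ≈ Δf(x) = Deg(x), a sum of d rates close to K/2.
  have h3 : |f x + d / 2| ≤ (√(A * D) + d * c) / K * σ := by
    rw [div_mul_eq_mul_div, le_div_iff₀ hK]
    calc |f x + d / 2| * K = |(f x + d / 2) * K| := by rw [abs_mul, abs_of_pos hK]
      _ = |(G.weightedDeg x + K * f x) - (G.weightedDeg x - d * (K / 2))| := by congr 1; ring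
      _ ≤ |G.weightedDeg x + K * f x| + |G.weightedDeg x - d * (K / 2)| := abs_sub _ _
      _ ≤ _ := by linarith
  refine ⟨f, hf, fun v => ?_⟩
  have h4 := h.abs_sub_sub_dist_le hA hσ hN hcard hE hconn hCD hD0 hf hΓ
    (fun y hy => hg y (hN.mem_of_adj hy)) _ v rfl
  have h5 : (5 : ℝ) ^ G.toSimpleGraph.dist x v * (4 * A * √(A * D) * σ)
      ≤ 5 ^ L * (4 * A * √(A * D) * σ) :=
    mul_le_mul_of_nonneg_right (pow_le_pow_right₀ (by norm_num) (hL x v)) (by positivity)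
  simp only [distFrom]
  rw [add_mul]
  rw [abs_le] at *
  constructor <;> linarith [h3.1, h3.2, h4.1, h4.2]

end AlmostRigid

/-! ### Spectral theory of -Δ: Lichnerowicz, diagonalization, ordered eigenvalues. -/

section Spectrum

variable [Fintype V]

theorem negLap_eq (f : V → ℝ) : G.negLap f = -G.lap f := rfl

theorem normSq_pos {f : V → ℝ} (hf : f ≠ 0) : 0 < G.normSq f := by
  obtain ⟨x, hx⟩ := Function.ne_iff.mp hf
  refine lt_of_lt_of_le ?_ (m_mul_sq_le_normSq f x)
  exact mul_pos (G.m_pos x) (sq_pos_of_ne_zero hx)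

theorem sum_Gam_eq_of_negLap_eq {μ : ℝ} {f : V → ℝ} (hf : G.negLap f = μ • f) :
    ∑ x, G.m x * G.Gam f f x = μ * G.normSq f := by
  have hl : ∀ x, G.lap f x = -(μ * f x) := fun x => by
    have := congrFun hf x
    simp only [negLap, LinearMap.coe_mk, AddHom.coe_mk, Pi.neg_apply, Pi.smul_apply,
      smul_eq_mul] at this
    linarith
  have h1 : ∑ x, G.m x * (f x * G.lap f x) = -(μ * G.normSq f) := by
    rw [normSq, Finset.mul_sum, ← Finset.sum_neg_distrib]
    exact Finset.sum_congr rfl fun x _ => by rw [hl]; ring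
  linarith [G.sum_m_mul_lap f f]

theorem eigenvalue_nonneg_of_negLap_eq {μ : ℝ} {f : V → ℝ} (hf : G.negLap f = μ • f)
    (hf0 : f ≠ 0) : 0 ≤ μ := by
  have h1 := sum_Gam_eq_of_negLap_eq hf
  have h2 : 0 ≤ ∑ x, G.m x * G.Gam f f x := Finset.sum_nonneg fun x _ =>
    mul_nonneg (G.m_pos x).le (covers_univ.Gam_self_nonneg f x)
  rw [h1] at h2
  exact nonneg_of_mul_nonneg_left h2 (normSq_pos hf0)

/-- The Lichnerowicz estimate. -/
theorem CDInfty.le_of_negLap_eq {K μ : ℝ} (hCD : G.CDInfty K) {f : V → ℝ}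
    (hf : G.negLap f = μ • f) (hf0 : f ≠ 0) (hμ : μ ≠ 0) : K ≤ μ := by
  have hμ0 : 0 < μ := lt_of_le_of_ne (eigenvalue_nonneg_of_negLap_eq hf hf0) hμ.symm
  have h1 := hCD.mul_sum_Gam_le f
  have h2 : G.normSq (G.lap f) = μ ^ 2 * G.normSq f := by
    rw [normSq, normSq, Finset.mul_sum]
    refine Finset.sum_congr rfl fun x _ => ?_
    have := congrFun hf x
    simp only [negLap, LinearMap.coe_mk, AddHom.coe_mk, Pi.neg_apply, Pi.smul_apply,
      smul_eq_mul] at this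
    rw [← neg_sq, this]; ring
  rw [sum_Gam_eq_of_negLap_eq hf, h2] at h1
  have h3 : K * (μ * G.normSq f) ≤ μ * (μ * G.normSq f) := by linarith
  exact le_of_mul_le_mul_right h3 (mul_pos hμ0 (normSq_pos hf0))

theorem eq_of_negLap_eq_zero (hconn : G.toSimpleGraph.Connected) {f : V → ℝ}
    (hf : G.negLap f = 0) (x y : V) : f x = f y := by
  have h1 := sum_Gam_eq_of_negLap_eq (G := G) (μ := 0) (f := f) (by rw [hf, zero_smul])
  rw [zero_mul, Finset.sum_eq_zero_iff_of_nonneg fun x _ =>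
    mul_nonneg (G.m_pos x).le (covers_univ.Gam_self_nonneg f x)] at h1
  have h2 : ∀ x y, G.toSimpleGraph.Adj x y → f x = f y := fun x y hxy => by
    have h3 := covers_univ.rate_mul_sq_le f hxy
    have h4 := (mul_eq_zero.mp (h1 x (Finset.mem_univ x))).resolve_left (G.m_pos x).ne'
    rw [h4, mul_zero] at h3
    have h5 : (f y - f x) ^ 2 ≤ 0 := by
      by_contra hn
      exact absurd h3 (not_le.mpr (mul_pos (rate_pos hxy) (not_le.mp hn)))
    have := pow_eq_zero_iff (two_ne_zero) |>.mp (le_antisymm h5 (sq_nonneg _))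
    linarith
  obtain ⟨q⟩ := hconn.preconnected x y
  induction q with
  | nil => rfl
  | cons hab _ ih => exact (h2 _ _ hab).trans ih

theorem m_mul_negLap_single_comm [DecidableEq V] (x y : V) :
    G.m x * G.negLap (Pi.single y 1) x = G.m y * G.negLap (Pi.single x 1) y := by
  have h : ∀ x y, x ≠ y → G.m x * G.negLap (Pi.single y 1) x = -G.w x y := by
    intro x y hxy
    simp only [negLap, LinearMap.coe_mk, AddHom.coe_mk, Pi.neg_apply, covers_univ.lap_eq]
    rw [Finset.sum_eq_single y]
    · rw [Pi.single_eq_same, Pi.single_eq_of_ne hxy, ← m_mul_rate]; ring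
    · intro z _ hz
      rw [Pi.single_eq_of_ne hz, Pi.single_eq_of_ne hxy]; ring
    · simp
  rcases eq_or_ne x y with rfl | hxy
  · rfl
  · rw [h x y hxy, h y x hxy.symm, G.w_symm]

/-- `-Δ` is diagonalizable with eigenfunctions orthonormal in `ℓ₂(V, m)`. -/
theorem exists_eigenbasis [DecidableEq V] (G : WeightedGraph V) : ∃ (e : V → ℝ) (b : V → V → ℝ),
    G.negLap.charpoly.roots = Finset.univ.val.map e ∧
    (∀ j, G.negLap (b j) = e j • b j) ∧
    ∀ i j, ∑ x, G.m x * (b i x * b j x) = if i = j then 1 else 0 := by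
  set A := LinearMap.toMatrix' G.negLap with hA
  set s : V → ℝ := fun x => √(G.m x) with hs
  have hs0 : ∀ x, s x ≠ 0 := fun x => (Real.sqrt_pos.mpr (G.m_pos x)).ne'
  have hs2 : ∀ x, s x * s x = G.m x := fun x => Real.mul_self_sqrt (G.m_pos x).le
  let U : (Matrix V V ℝ)ˣ := ⟨Matrix.diagonal s, Matrix.diagonal s⁻¹, by
    rw [Matrix.diagonal_mul_diagonal, ← Matrix.diagonal_one]
    congr 1; funext x; exact mul_inv_cancel₀ (hs0 x), by
    rw [Matrix.diagonal_mul_diagonal, ← Matrix.diagonal_one]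
    congr 1; funext x; exact inv_mul_cancel₀ (hs0 x)⟩
  -- Conjugation by √m turns self-adjointness in ℓ₂(V, m) into symmetry of a matrix with the same
  -- characteristic polynomial.
  set H : Matrix V V ℝ := Matrix.diagonal s * A * Matrix.diagonal s⁻¹ with hHdef
  have hHc : H.charpoly = G.negLap.charpoly := by
    have h := Matrix.charpoly_units_conj U A
    rw [← Matrix.coe_units_inv] at h
    change H.charpoly = A.charpoly at h
    rw [h, hA, ← LinearMap.toMatrix_eq_toMatrix', LinearMap.charpoly_toMatrix]
  have hH : H.IsHermitian := by
    refine Matrix.IsHermitian.ext fun x y => ?_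
    rw [star_trivial, hHdef, Matrix.mul_diagonal, Matrix.diagonal_mul, Matrix.mul_diagonal,
      Matrix.diagonal_mul, hA, LinearMap.toMatrix'_apply, LinearMap.toMatrix'_apply]
    have h := m_mul_negLap_single_comm (G := G) x y
    rw [← hs2, ← hs2] at h
    have hx := hs0 x
    have hy := hs0 y
    simp only [Pi.inv_apply]
    field_simp
    linarith
  have hroots := hH.roots_charpoly_eq_eigenvalues
  rw [hHc] at hroots
  refine ⟨hH.eigenvalues, fun j x => (s x)⁻¹ * (hH.eigenvectorBasis j).ofLp x, hroots, ?_, ?_⟩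
  · intro j
    have h1 := hH.mulVec_eigenvectorBasis j
    set v := (hH.eigenvectorBasis j).ofLp with hv
    have h2 : (fun x => (s x)⁻¹ * v x) = Matrix.mulVec (Matrix.diagonal s⁻¹) v := by
      funext x; rw [Matrix.mulVec_diagonal]; rfl
    have h3 : G.negLap (fun x => (s x)⁻¹ * v x)
        = Matrix.mulVec (Matrix.diagonal s⁻¹) (Matrix.mulVec H v) := by
      rw [h2, ← LinearMap.toMatrix'_mulVec, ← hA, hHdef, Matrix.mulVec_mulVec,
        Matrix.mulVec_mulVec]
      congr 1
      have h4 : Matrix.diagonal s⁻¹ * Matrix.diagonal s = 1 := U.inv_mul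
      rw [← mul_assoc, ← mul_assoc, h4, one_mul]
    rw [h3, h1, Matrix.mulVec_smul, ← h2]
  · intro i j
    have h1 := orthonormal_iff_ite.mp hH.eigenvectorBasis.orthonormal i j
    rw [← h1, PiLp.inner_apply]
    refine Finset.sum_congr rfl fun x _ => ?_
    have hx := hs0 x
    rw [← hs2]
    simp only [RCLike.inner_apply, conj_trivial]
    field_simp

/-- Connectedness makes the eigenvalue 0 simple, so every entry of positive index is nonzero and the
Lichnerowicz estimate applies to it. -/
theorem le_eigenvalue_and_eigenvalue_le {K : ℝ} (hconn : G.toSimpleGraph.Connected)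
    (hCD : G.CDInfty K) {k l : ℕ} (hk : 0 < k) (hkl : k ≤ l)
    (hl : l < Fintype.card V) : K ≤ G.eigenvalue k ∧ G.eigenvalue k ≤ G.eigenvalue l := by
  classical
  obtain ⟨e, b, hroots, heig, horth⟩ := G.exists_eigenbasis
  have hb0 : ∀ j, b j ≠ 0 := fun j h0 => by
    have := horth j j
    simp [h0] at this
  set L := G.negLap.charpoly.roots.sort (· ≤ ·) with hL
  have hLr : (L : Multiset ℝ) = Finset.univ.val.map e := by
    rw [hL, Multiset.sort_eq, hroots]
  have hlen : L.length = Fintype.card V := by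
    have := congrArg Multiset.card hLr
    simpa using this
  have hsort : L.Pairwise (· ≤ ·) := Multiset.pairwise_sort _ _
  have hmono : ∀ i j (hi : i < L.length) (hj : j < L.length), i ≤ j → L[i] ≤ L[j] := by
    intro i j hi hj hij
    rcases hij.lt_or_eq with hlt | rfl
    · exact List.pairwise_iff_getElem.mp hsort i j hi hj hlt
    · exact le_rfl
  -- All indices used lie below |V|, so the default value 0 of `getD` never enters.
  have hval : ∀ i, (hi : i < L.length) → G.eigenvalue i = L[i] := fun i hi =>
    List.getD_eq_getElem L 0 hi
  have hmem : ∀ i, (hi : i < L.length) → ∃ j, e j = L[i] := by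
    intro i hi
    have : L[i] ∈ (L : Multiset ℝ) := List.getElem_mem hi
    rw [hLr, Multiset.mem_map] at this
    obtain ⟨j, -, hj⟩ := this
    exact ⟨j, hj⟩
  -- Functions in the kernel are constant, and two nonzero constants are never orthogonal.
  have hcount : L.count 0 ≤ 1 := by
    rw [← Multiset.coe_count, hLr, Multiset.count_map]
    have : (Finset.univ.filter fun j => 0 = e j).card ≤ 1 := by
      refine Finset.card_le_one.mpr fun i hi j hj => ?_
      have hi0 : G.negLap (b i) = 0 := by
        rw [heig i, ← (Finset.mem_filter.mp hi).2, zero_smul]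
      have hj0 : G.negLap (b j) = 0 := by
        rw [heig j, ← (Finset.mem_filter.mp hj).2, zero_smul]
      have hci := eq_of_negLap_eq_zero hconn hi0
      have hcj := eq_of_negLap_eq_zero hconn hj0
      by_contra hij
      have h0 := horth i j
      rw [if_neg hij, Finset.sum_congr rfl fun x _ => by rw [hci x i, hcj x i],
        ← Finset.sum_mul] at h0
      have hm : 0 < ∑ x, G.m x := Finset.sum_pos (fun x _ => G.m_pos x) ⟨i, Finset.mem_univ i⟩
      rcases mul_eq_zero.mp ((mul_eq_zero.mp h0).resolve_left hm.ne') with h | h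
      · exact hb0 i (funext fun x => (hci x i).trans h)
      · exact hb0 j (funext fun x => (hcj x i).trans h)
    exact this
  have hl' : l < L.length := by rw [hlen]; exact hl
  have hk' : k < L.length := by omega
  rw [hval k hk', hval l hl']
  refine ⟨?_, hmono k l hk' hl' hkl⟩
  obtain ⟨j, hj⟩ := hmem k hk'
  rw [← hj]
  refine hCD.le_of_negLap_eq (heig j) (hb0 j) fun hj0 => ?_
  obtain ⟨i, hi⟩ := hmem 0 (by omega)
  have h0 : L[0] = 0 := by
    refine le_antisymm ?_ (hi ▸ eigenvalue_nonneg_of_negLap_eq (heig i) (hb0 i))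
    exact (hmono 0 k (by omega) hk' hk.le).trans (by rw [← hj, hj0])
  have hdup : L.Duplicate 0 := List.duplicate_iff_exists_distinct_get.mpr
    ⟨⟨0, by omega⟩, ⟨k, hk'⟩, hk, h0.symm, (hj.symm.trans hj0).symm⟩
  have := List.duplicate_iff_two_le_count.mp hdup
  omega

theorem ip_eq_sum (f g : V → ℝ) : G.ip f g = ∑ x, G.m x * (f x * g x) := by
  rw [ip, tsum_fintype]
  exact Finset.sum_congr rfl fun x _ => by ring

theorem normSq_sum_smul {d : ℕ} {φ : Fin d → V → ℝ}
    (hφ : ∀ i j, G.ip (φ i) (φ j) = if i = j then 1 else 0) (a : Fin d → ℝ) :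
    G.normSq (∑ i, a i • φ i) = ∑ i, a i ^ 2 := by
  have h1 : G.normSq (∑ i, a i • φ i) = ∑ i, ∑ j, a i * a j * G.ip (φ i) (φ j) := by
    simp only [normSq, ip_eq_sum, Finset.mul_sum]
    rw [Finset.sum_congr rfl fun i _ => Finset.sum_comm, Finset.sum_comm]
    refine Finset.sum_congr rfl fun x _ => ?_
    rw [Finset.sum_apply, sq, Finset.sum_mul_sum, Finset.mul_sum]
    refine Finset.sum_congr rfl fun i _ => ?_
    rw [Finset.mul_sum]
    refine Finset.sum_congr rfl fun j _ => ?_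
    simp only [Pi.smul_apply, smul_eq_mul]; ring
  rw [h1]
  refine Finset.sum_congr rfl fun i _ => ?_
  simp [hφ, sq]

theorem IsEigenfamily.finrank_span {d : ℕ} {φ : Fin d → V → ℝ} (h : G.IsEigenfamily d φ) :
    Module.finrank ℝ (Submodule.span ℝ (Set.range φ)) = d := by
  have hli : LinearIndependent ℝ φ := by
    rw [Fintype.linearIndependent_iff]
    intro a ha i
    have h1 := normSq_sum_smul h.orthonormal a
    rw [ha] at h1
    have h2 : ∑ i, a i ^ 2 = 0 := by rw [← h1]; simp [normSq]
    rw [Finset.sum_eq_zero_iff_of_nonneg fun i _ => sq_nonneg _] at h2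
    exact pow_eq_zero_iff (two_ne_zero) |>.mp (h2 i (Finset.mem_univ i))
  rw [finrank_span_eq_card hli, Fintype.card_fin]

theorem IsEigenfamily.normSq_le {K ε : ℝ} {d : ℕ} {φ : Fin d → V → ℝ}
    (h : G.IsEigenfamily d φ)
    (hK : ∀ i : Fin d, K ≤ G.eigenvalue (i + 1) ∧ G.eigenvalue (i + 1) ≤ K + ε)
    {f : V → ℝ} (hf : f ∈ Submodule.span ℝ (Set.range φ)) :
    G.normSq (G.lap f + K • f) ≤ ε ^ 2 * G.normSq f := by
  obtain ⟨a, rfl⟩ := (Submodule.mem_span_range_iff_exists_fun ℝ).mp hf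
  have h1 : G.lap (∑ i, a i • φ i) + K • ∑ i, a i • φ i
      = ∑ i, (a i * (K - G.eigenvalue (i + 1))) • φ i := by
    have h2 : G.negLap (∑ i, a i • φ i) = ∑ i, (a i * G.eigenvalue (i + 1)) • φ i := by
      rw [map_sum]
      refine Finset.sum_congr rfl fun i _ => ?_
      rw [map_smul, h.eigen, smul_smul]
    have h3 : G.lap (∑ i, a i • φ i) = -G.negLap (∑ i, a i • φ i) := by
      rw [negLap_eq, neg_neg]
    rw [h3, h2, Finset.smul_sum, ← Finset.sum_neg_distrib, ← Finset.sum_add_distrib]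
    refine Finset.sum_congr rfl fun i _ => ?_
    module
  rw [h1, normSq_sum_smul h.orthonormal, normSq_sum_smul h.orthonormal, Finset.mul_sum]
  refine Finset.sum_le_sum fun i _ => ?_
  have := hK i
  rw [mul_pow, mul_comm]
  refine mul_le_mul_of_nonneg_right ?_ (sq_nonneg _)
  apply sq_le_sq'
  · linarith
  · linarith

/-- Ensures that λ_d is a genuine entry of the eigenvalue list. -/
theorem lt_card_of_combDegMax_eq {d : ℕ} (hd : 0 < d) (h : G.combDegMax = (d : ℕ∞)) :
    d < Fintype.card V := by
  obtain ⟨N, hN, hcard, hadj⟩ := exists_covers h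
  by_contra hn
  have h1 : ∀ x, G.combDeg x ≤ ((d - 1 : ℕ) : ℕ∞) := by
    intro x
    have : {y | G.toSimpleGraph.Adj x y} ⊂ Set.univ := by
      refine Set.ssubset_univ_iff.mpr fun heq => ?_
      have : x ∈ {y | G.toSimpleGraph.Adj x y} := by rw [heq]; trivial
      exact G.toSimpleGraph.loopless.irrefl x this
    have h2 := Set.ncard_lt_ncard this
    rw [Set.ncard_univ, Nat.card_eq_fintype_card] at h2
    rw [combDeg, ← (Set.toFinite _).cast_ncard_eq]
    exact_mod_cast (by omega)
  have h2 : (d : ℕ∞) ≤ ((d - 1 : ℕ) : ℕ∞) := h ▸ iSup_le h1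
  have h3 : d ≤ d - 1 := by exact_mod_cast h2
  omega

end Spectrum

/-! ### Uniform estimates and the passage to a class depending on d and K only. -/

theorem NearExtremal.exists_estimates (d : ℕ) {D K δ : ℝ} (hK : 0 < K) (hD : 0 < D)
    (hδ : 0 < δ) :
    ∃ B ε₁ : ℝ, 0 < B ∧ 0 < ε₁ ∧ ∀ (V : Type*) [Fintype V] (G : WeightedGraph V)
      (E : Submodule ℝ (V → ℝ)) (ε : ℝ), G.combDegMax = (d : ℕ∞) →
        Fintype.card V ≤ (d + 1) ^ ⌈4 * D / K⌉₊ → Module.finrank ℝ E = d → 0 ≤ ε → ε ≤ ε₁ →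
        G.NearExtremal D K δ ε E →
          (∀ x, ∃ f ∈ E, ∀ v, |G.distFrom x v - d / 2 - f v| ≤ B * √ε) ∧
          (∀ x y, G.toSimpleGraph.Adj x y → |G.rate x y - K / 2| ≤ B * √ε) ∧
          ∀ x y, |G.m x - G.m y| ≤ B * √ε := by
  set L := ⌈4 * D / K⌉₊ with hL
  obtain ⟨A, ε₁, hA, hε₁, hmain⟩ := exists_almostRigid (n := ((d : ℝ) + 1) ^ L) hD hK hδ
    (by positivity)
  set c := √(A * D) + D * √(2 * A) + A * D with hc
  set B₁ := 5 ^ L * (4 * A * √(A * D)) + (√(A * D) + d * c) / K with hB₁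
  set B₃ := L * (2 * A ^ 2 * D * δ) with hB₃
  -- The summands serve the distance, the rates and the measure. They depend on d, D, K and δ only,
  -- so the estimates can be reused with D = dK and δ = 2.
  refine ⟨B₁ + c + B₃, min ε₁ 1, by positivity, by positivity, ?_⟩
  intro V _ G E ε hdeg hcardV hE hε hεle h
  obtain ⟨N, hN, hcard, hadj⟩ := exists_covers hdeg
  have hr := hmain V G E ε (by exact_mod_cast hcardV) hε (hεle.trans (min_le_left _ _)) h
  have hσ := Real.sqrt_nonneg ε
  have hσ1 : √ε ≤ 1 := Real.sqrt_le_one.mpr (hεle.trans (min_le_right _ _))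
  have hle : ∀ b, b ≤ B₁ + c + B₃ → b * √ε ≤ (B₁ + c + B₃) * √ε := fun b hb =>
    mul_le_mul_of_nonneg_right hb hσ
  have hB₁0 : 0 ≤ B₁ := by positivity
  have hc0 : 0 ≤ c := by positivity
  have hB₃0 : 0 ≤ B₃ := by positivity
  have hdist : ∀ x y, G.toSimpleGraph.dist x y ≤ L := fun x y => by
    have := (hN.dist_le h.connected h.weightedDeg_le h.curvature hD hK x y).trans (Nat.le_ceil _)
    exact_mod_cast this
  refine ⟨fun x => ?_, fun x y hxy => ?_, fun x y => ?_⟩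
  · obtain ⟨f, hf, hfv⟩ := hr.exists_abs_distFrom_sub_le hA hσ hσ1 hN hcard
      (fun x y hy => (hadj x y).mp hy) hE h.connected h.weightedDeg_le h.curvature hD.le hK hdist x
    exact ⟨f, hf, fun v => (hfv v).trans (hle _ (by linarith))⟩
  · exact (hr.abs_rate_sub_le hA hσ hσ1 hN hcard hE h.weightedDeg_le hD.le hxy).trans
      (hle _ (by linarith))
  · refine (abs_m_sub_le h.connected (fun x y hxy =>
      hr.abs_m_sub_le_of_adj hA hN hcard hE h.weightedDeg_le h.m_le hxy) x y).trans ?_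
    refine le_trans ?_ (hle B₃ (by linarith))
    have h1 : (G.toSimpleGraph.dist x y : ℝ) ≤ L := by exact_mod_cast hdist x y
    have h2 : √ε ^ 2 ≤ √ε := by nlinarith
    calc _ ≤ (L : ℝ) * (2 * A ^ 2 * D * δ * √ε) :=
          mul_le_mul h1 (mul_le_mul_of_nonneg_left h2 (by positivity)) (by positivity)
            (by positivity)
      _ = _ := by rw [hB₃]; ring

/-- Almost extremal graphs have almost unit measure and almost the weights of a hypercube, so
they lie in a class with parameters depending on `d` and `K` only. -/
theorem MemClass.of_estimates {D K δ b : ℝ} {d : ℕ} (hG : G.MemClass D d δ)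
    (hone : ∃ x, G.m x = 1) (hb : b ≤ K / 2) (hb1 : b ≤ 1 / 2) (hK : 0 < K)
    (hrate : ∀ x y, G.toSimpleGraph.Adj x y → |G.rate x y - K / 2| ≤ b)
    (hm : ∀ x y, |G.m x - G.m y| ≤ b) : G.MemClass (d * K) d 2 := by
  obtain ⟨N, hN, hcard, hadj⟩ := exists_covers hG.combDegMax_eq
  obtain ⟨x₁, hx₁⟩ := hone
  refine ⟨hG.connected, hG.combDegMax_eq, fun x => ?_, fun x => ?_, fun x => ?_⟩
  · rw [hN.weightedDeg_eq]
    calc ∑ y ∈ N x, G.rate x y ≤ ∑ _y ∈ N x, K := Finset.sum_le_sum fun y hy => by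
          have := (abs_le.mp (hrate x y ((hadj x y).mp hy))).2
          linarith
      _ = (N x).card * K := by rw [Finset.sum_const, nsmul_eq_mul]
      _ ≤ d * K := mul_le_mul_of_nonneg_right (by exact_mod_cast hcard x) hK.le
  · have := (abs_le.mp (hm x x₁)).1
    rw [hx₁] at this
    norm_num; linarith
  · have := (abs_le.mp (hm x x₁)).2
    rw [hx₁] at this
    linarith

theorem MemClass.nearExtremal [Fintype V] {D K δ ε : ℝ} {d : ℕ} (hG : G.MemClass D d δ)
    (hδ : 0 < δ) (hCD : G.CDInfty K) {E : Submodule ℝ (V → ℝ)}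
    (hE : ∀ f ∈ E, G.normSq (G.lap f + K • f) ≤ ε ^ 2 * G.normSq f) :
    G.NearExtremal D K δ ε E :=
  ⟨hG.connected, hCD, hG.weightedDeg_le, fun x => by
    have := mul_le_mul_of_nonneg_left (hG.le_m x) hδ.le
    rwa [mul_inv_cancel₀ hδ.ne'] at this, hG.m_le, hE⟩

theorem norm2_le [Fintype V] {n δ b : ℝ} (hn : (Fintype.card V : ℝ) ≤ n)
    (hδ : 0 < δ) (hm : ∀ x, G.m x ≤ δ) {f : V → ℝ} (hb : 0 ≤ b) (hf : ∀ x, |f x| ≤ b) :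
    G.norm2 f ≤ √(n * δ) * b := by
  have hn0 : 0 ≤ n := (Nat.cast_nonneg _).trans hn
  rw [norm2, tsum_fintype]
  refine Real.sqrt_le_iff.mpr ⟨by positivity, ?_⟩
  rw [mul_pow, Real.sq_sqrt (by positivity)]
  calc ∑ x, |f x| ^ 2 * G.m x ≤ ∑ _x : V, b ^ 2 * δ := Finset.sum_le_sum fun x _ =>
        mul_le_mul (pow_le_pow_left₀ (abs_nonneg _) (hf x) 2) (hm x) (G.m_pos x).le (by positivity)
    _ = Fintype.card V * (b ^ 2 * δ) := by simp
    _ ≤ n * (b ^ 2 * δ) := mul_le_mul_of_nonneg_right hn (by positivity)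
    _ = _ := by ring

end

end WeightedGraph

open WeightedGraph in
theorem mainTheorem2 (d : ℕ) (hd : 0 < d) (K : ℝ) (hK : 0 < K) :
    ∃ C : ℝ, 0 < C ∧
      ∀ D δ : ℝ, 0 < D → 1 < δ →
        ∃ ε₀ : ℝ, 0 < ε₀ ∧
          ∀ (V : Type*) (G : WeightedGraph V),
            G.MemClass D d δ → (∃ x, G.m x = 1) → G.CDInfty K →
              ∃ _ : Finite V,
                G.eigenvalue d ≤ K + ε₀ →
                  ∀ φ : Fin d → V → ℝ, G.IsEigenfamily d φ →
                    ∀ x₀ : V, ∃ u ∈ Submodule.span ℝ (Set.range φ),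
                      G.norm2 (fun x => G.distFrom x₀ x - (d : ℝ) / 2 - u x)
                        ≤ C * (G.eigenvalue d - K) ^ (1 / 2 : ℝ) := by
  have hdK : 0 < (d : ℝ) * K := by positivity
  -- The constants of the final class 𝒢(dK, d, 2) are fixed before D and δ, so C depends on d and K
  -- only; √(2n) converts a sup bound into an ℓ₂ bound for at most n vertices of measure at most 2.
  obtain ⟨B', ε', hB', hε', huniv⟩ := NearExtremal.exists_estimates d hK hdK two_pos
  set n : ℝ := ((d : ℝ) + 1) ^ ⌈4 * (d * K) / K⌉₊ with hn
  refine ⟨√(n * 2) * B', by positivity, fun D δ hD hδ => ?_⟩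
  have hδ0 : 0 < δ := one_pos.trans hδ
  obtain ⟨B, ε₁, hB, hε₁, hcrude⟩ := NearExtremal.exists_estimates d hK hD hδ0
  -- Below this threshold the crude estimates give rates at most K and, as m equals 1 somewhere,
  -- values of m in [1/2, 3/2].
  set t := min (K / 2) (1 / 2) / B with ht
  have ht0 : 0 < t := by positivity
  refine ⟨min ε' (min ε₁ (t ^ 2)), by positivity, fun V G hG hone hCD => ?_⟩
  obtain ⟨hfin, hcard⟩ := hG.finite_and_card_le hD hK hCD
  refine ⟨hfin, fun hle φ hφ x₀ => ?_⟩
  have : Fintype V := Fintype.ofFinite V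
  rw [Nat.card_eq_fintype_card] at hcard
  have hdV := lt_card_of_combDegMax_eq hd hG.combDegMax_eq
  set ε := G.eigenvalue d - K with hε
  have hε0 : 0 ≤ ε :=
    sub_nonneg.mpr (le_eigenvalue_and_eigenvalue_le hG.connected hCD hd le_rfl hdV).1
  have hεle : ε ≤ min ε' (min ε₁ (t ^ 2)) := by linarith
  have hE : ∀ f ∈ Submodule.span ℝ (Set.range φ),
      G.normSq (G.lap f + K • f) ≤ ε ^ 2 * G.normSq f := fun f hf =>
    hφ.normSq_le (fun i => by
      have := le_eigenvalue_and_eigenvalue_le hG.connected hCD (k := i + 1) (l := d) (by omega)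
        i.isLt hdV
      exact ⟨this.1, by linarith [this.2]⟩) hf
  obtain ⟨-, hrate, hm⟩ := hcrude V G _ ε hG.combDegMax_eq hcard hφ.finrank_span hε0
    (hεle.trans ((min_le_right _ _).trans (min_le_left _ _))) (hG.nearExtremal hδ0 hCD hE)
  have hb : B * √ε ≤ min (K / 2) (1 / 2) := by
    have h1 : √ε ≤ t := (Real.sqrt_le_left ht0.le).mpr
      (hεle.trans ((min_le_right _ _).trans (min_le_right _ _)))
    rw [ht, le_div_iff₀ hB] at h1
    linarith
  have hG' := hG.of_estimates hone (hb.trans (min_le_left _ _)) (hb.trans (min_le_right _ _)) hK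
    hrate hm
  -- The first bound on |V| involved D; the Bonnet–Myers bound in the new class does not.
  have hcard' := (hG'.finite_and_card_le hdK hK hCD).2
  rw [Nat.card_eq_fintype_card] at hcard'
  obtain ⟨u, hu, huv⟩ := (huniv V G _ ε hG.combDegMax_eq hcard' hφ.finrank_span hε0
    (hεle.trans (min_le_left _ _)) (hG'.nearExtremal two_pos hCD hE)).1 x₀
  refine ⟨u, hu, ?_⟩
  rw [← Real.sqrt_eq_rpow, mul_assoc]
  exact norm2_le (by rw [hn]; exact_mod_cast hcard') two_pos hG'.m_le (by positivity) huv
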